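/- Let $\mathbb{D}$ be the open unit disc, $dA=\frac1\pi\,dx\,dy$, $0<p<\infty$, $0<q<\infty$, and let $\mu$ be a positive Borel measure on $\mathbb{D}$. For an arc $I\subset\partial\mathbb{D}$ of normalized length $|I|\in(0,1]$ (so that $|\partial\mathbb{D}|=1$) put $$S(I)=\{r\zeta\in\mathbb{D}:\ 1-|I|\le r<1,\ \zeta\in I\}.$$ - $\mathcal{D}^p_{p-1}$ is the space of analytic functions $f$ on $\mathbb{D}$ with $\|f\|_{\mathcal{D}^p_{p-1}}=\Big(|f(0)|^p+\int_{\mathbb{D}}|f'(z)|^p(1-|z|^2)^{p-1}\,dA(z)\Big)^{1/p}<\infty$. - $A^p_{q-1}$ is the weighted Bergman space of analytic functions $f$ on $\mathbb{D}$ with $\|f\|_{A^p_{q-1}}=\Big(q\int_{\mathbb{D}}|f(z)|^p(1-|z|^2)^{q-1}\,dA(z)\Big)^{1/p}<\infty$. - $T_{p,q}(\mu)$ is the tent space of $\mu$-measurable functions $f$ on $\mathbb{D}$ (modulo $\mu$-null sets) with $\|f\|_{T_{p,q}}=\Big(\sup_{I\subset\partial\mathbb{D}}\frac{1}{|I|^{q}}\int_{S(I)}|f|^p\,d\mu\Big)^{1/p}<\infty$.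 - For $s>0$, $\mu$ is an $s$-Carleson measure if $\sup_{I\subset\partial\mathbb{D}}\frac{\mu(S(I))}{|I|^s}<\infty$, and a vanishing $s$-Carleson measure if, moreover, $\lim_{|I|\to0}\frac{\mu(S(I))}{|I|^s}=0$, uniformly in the position of $I$. - The inclusion of one of these (quasi-)normed spaces $X$ into another, $Y$, is compact if every $f\in X$ belongs to $Y$ and every bounded sequence in $X$ has a subsequence that converges in $Y$. **Theorem.** The following statements are equivalent: 1. the inclusion mapping $i:\mathcal{D}^p_{p-1}\to T_{p,q}(\mu)$ is compact; 2. $\mu$ is a vanishing $(q+1)$-Carleson measure; 3. the inclusion mapping $i:A^p_{q-1}\to L^p(\mu)$ is compact. -/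

import Mathlib

open MeasureTheory Filter Topology Set
open scoped ENNReal NNReal

noncomputable section

namespace DirichletEmbedding

/-- The open unit disc `𝔻` of the complex plane. -/
def unitDisc : Set ℂ := Metric.ball 0 1

/-- The normalized area measure `dA = (1/π) dx dy`. -/
def areaMeasure : Measure ℂ := (ENNReal.ofReal Real.pi)⁻¹ • (volume : Measure ℂ)

/-- The (closed) arc of the unit circle with midpoint `e^{iθ}` and normalized length `ℓ`,
where `0 < ℓ ≤ 1` (normalized means that the full circle, `ℓ = 1`, has length `1`). -/
def arc (θ ℓ : ℝ) : Set ℂ :=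
  (fun t : ℝ => Complex.exp (t * Complex.I)) '' Icc (θ - Real.pi * ℓ) (θ + Real.pi * ℓ)

/-- The Carleson square `S(I) = {rζ ∈ 𝔻 : 1 - |I| ≤ r < 1, ζ ∈ I}` over the arc `I = arc θ ℓ`. -/
def carlesonSquare (θ ℓ : ℝ) : Set ℂ :=
  {z | ∃ r : ℝ, ∃ ζ ∈ arc θ ℓ, 1 - ℓ ≤ r ∧ r < 1 ∧ z = r * ζ}

/-- `‖μ‖_s = sup_I μ(S(I)) / |I|^s`, the supremum over all arcs `I`. -/
def carlesonNorm (s : ℝ) (μ : Measure ℂ) : ℝ≥0∞ :=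
  ⨆ (θ : ℝ) (ℓ : ℝ) (_ : ℓ ∈ Ioc (0 : ℝ) 1), μ (carlesonSquare θ ℓ) / ENNReal.ofReal (ℓ ^ s)

/-- `μ` is an `s`-Carleson measure. -/
def IsCarlesonMeasure (s : ℝ) (μ : Measure ℂ) : Prop :=
  carlesonNorm s μ < ∞

/-- `μ` is a vanishing `s`-Carleson measure: an `s`-Carleson measure for which, moreover,
`μ(S(I)) / |I|^s → 0` as `|I| → 0` (uniformly in the position of the arc `I`). -/
def IsVanishingCarlesonMeasure (s : ℝ) (μ : Measure ℂ) : Prop :=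
  IsCarlesonMeasure s μ ∧
    Tendsto (fun ℓ : ℝ => ⨆ θ : ℝ, μ (carlesonSquare θ ℓ) / ENNReal.ofReal (ℓ ^ s))
      (𝓝[>] 0) (𝓝 0)

/-- The (quasi-)norm of the Dirichlet type space `D^p_{p-1}`. -/
def dirichletNorm (p : ℝ) (f : ℂ → ℂ) : ℝ≥0∞ :=
  (‖f 0‖ₑ ^ p + ∫⁻ z in unitDisc,
    ‖deriv f z‖ₑ ^ p * ENNReal.ofReal ((1 - ‖z‖ ^ 2) ^ (p - 1)) ∂areaMeasure) ^ (1 / p)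

/-- The Dirichlet type space `D^p_{p-1}`: analytic functions on the disc of finite norm.
The values of `f` off the disc play no role. -/
def dirichletSpace (p : ℝ) : Set (ℂ → ℂ) :=
  {f | DifferentiableOn ℂ f unitDisc ∧ dirichletNorm p f < ∞}

/-- The (quasi-)norm of the weighted Bergman space `A^p_α`, `α > -1`. -/
def bergmanNorm (p α : ℝ) (f : ℂ → ℂ) : ℝ≥0∞ :=
  (∫⁻ z in unitDisc,
    ‖f z‖ₑ ^ p * ENNReal.ofReal ((α + 1) * (1 - ‖z‖ ^ 2) ^ α) ∂areaMeasure) ^ (1 / p)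

/-- The weighted Bergman space `A^p_α`: analytic functions on the disc of finite norm. -/
def bergmanSpace (p α : ℝ) : Set (ℂ → ℂ) :=
  {f | DifferentiableOn ℂ f unitDisc ∧ bergmanNorm p α f < ∞}

/-- The (quasi-)norm of the tent space `T_{p,q}(μ)`:
`‖f‖^p = sup_I |I|^{-q} ∫_{S(I)} |f|^p dμ`. -/
def tentNorm (p q : ℝ) (μ : Measure ℂ) (f : ℂ → ℂ) : ℝ≥0∞ :=
  (⨆ (θ : ℝ) (ℓ : ℝ) (_ : ℓ ∈ Ioc (0 : ℝ) 1),
    (∫⁻ z in carlesonSquare θ ℓ, ‖f z‖ₑ ^ p ∂μ) / ENNReal.ofReal (ℓ ^ q)) ^ (1 / p)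

/-- The tent space `T_{p,q}(μ)`, functions being understood modulo `μ`-null sets. -/
def tentSpace (p q : ℝ) (μ : Measure ℂ) : Set (ℂ → ℂ) :=
  {f | AEStronglyMeasurable f μ ∧ tentNorm p q μ f < ∞}

/-- The (quasi-)norm of `L^p(μ)` for a real exponent `p`. -/
def lebesgueNorm (p : ℝ) (μ : Measure ℂ) (f : ℂ → ℂ) : ℝ≥0∞ :=
  eLpNorm f (ENNReal.ofReal p) μ

/-- The space `L^p(μ)` for a real exponent `p`. -/
def lebesgueSpace (p : ℝ) (μ : Measure ℂ) : Set (ℂ → ℂ) :=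
  {f | MemLp f (ENNReal.ofReal p) μ}

/-- The inclusion of the space `X` (with (quasi-)norm `NX`) into the space `Y` (with (quasi-)norm
`NY`) is well defined and compact: `X ⊆ Y`, and every bounded sequence of `X` has a subsequence
that converges in `Y`. -/
def IsCompactInclusion (X : Set (ℂ → ℂ)) (NX : (ℂ → ℂ) → ℝ≥0∞)
    (Y : Set (ℂ → ℂ)) (NY : (ℂ → ℂ) → ℝ≥0∞) : Prop :=
  X ⊆ Y ∧
    ∀ f : ℕ → ℂ → ℂ, (∀ n, f n ∈ X) → (∃ C : ℝ≥0, ∀ n, NX (f n) ≤ C) →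
      ∃ g ∈ Y, ∃ φ : ℕ → ℕ, StrictMono φ ∧
        Tendsto (fun n => NY (fun z => f (φ n) z - g z)) atTop (𝓝 0)

end DirichletEmbedding

end

open DirichletEmbedding

namespace DirichletEmbedding

/-! Both embeddings are governed by the Carleson condition of order `q + 1`. Their bounds are linear
in the Carleson constant, and for a vanishing Carleson measure the constant of μ restricted to `r <
|z|` is arbitrarily small for suitable r < 1
(`IsVanishingCarlesonMeasure.exists_isBallCarleson_restrict`).

Sufficiency. For every p > 0 the value of |f|^p at a point is at most a constant times its average
over a disc about it. Inserting this into an integral against ν and exchanging the order of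
integration (`setLIntegral_le_of_kernel`) leaves ν-integrals of a transposed kernel, which the
Carleson condition bounds. For the Bergman space this is immediate
(`exists_lintegral_le_of_isBallCarleson`). For the tent space, f on S(I) is split into its value at
the base point (1 - |I|)ζ, whose p-th power is at most a constant times the Dirichlet size over |I|,
and the radial oscillation above that point. The latter is controlled by an integral of |f'|^p over
points u with 1 - |u| < 2|I|, and this truncation produces the factor |I|^q
(`exists_lintegral_carlesonSquare_le`). A bounded sequence has a locally uniformly convergent
subsequence by Montel, and Fatou keeps the limit in the space. The difference from the limit is
small on |z| ≤ r by uniform convergence, and negligible near the circle because the Carleson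
constant is small there (`exists_compact_of_vanishing`).

Necessity. The functions ℓ^(m-β) / (1 - āz)^m with |a| = 1 - ℓ are bounded in the space when β is
(q+1)/p (Bergman) or 1/p (Dirichlet) and m is large. They tend to 0 pointwise as ℓ → 0, yet have
size at least a constant times ℓ^(-β) on their own Carleson square. Compactness gives a
subsequential norm limit, which Fatou identifies with 0, so the norms tend to 0 along a subsequence;
they dominate μ(S(I)) / |I|^(q+1). In the tent space β supplies one power of |I| and the norm
supplies the other q. -/

/-! ### Sub-mean value inequality for |f|^p -/

open Metric in
/-- The area form of the sub-mean value inequality for `|f|`. -/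
theorem enorm_center_le_lintegral_ball {f : ℂ → ℂ} {c : ℂ} {r : ℝ} (hr : 0 < r)
    (hf : DifferentiableOn ℂ f (ball c r)) :
    ENNReal.ofReal (Real.pi * r ^ 2) * ‖f c‖ₑ ≤ ∫⁻ z in ball c r, ‖f z‖ₑ := by
  classical
  have hcirc : ∀ s ∈ Ioo (0 : ℝ) r, ENNReal.ofReal (2 * Real.pi) * ‖f c‖ₑ ≤
      ∫⁻ t in Ioo (-Real.pi) Real.pi, ‖f (circleMap c s t)‖ₑ := by
    intro s hs
    have hd : DiffContOnCl ℂ f (ball c |s|) := by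
      rw [abs_of_pos hs.1]
      exact (hf.mono (closedBall_subset_ball hs.2)).diffContOnCl_ball subset_rfl
    have h1 := hd.circleAverage
    have hper : Function.Periodic (fun t => f (circleMap c s t)) (2 * Real.pi) :=
      fun t => by simp only [periodic_circleMap c s t]
    -- The angle is moved to (-π, π), the range used by polar coordinates.
    have h2 := hper.intervalIntegral_add_eq 0 (-Real.pi)
    rw [show -Real.pi + 2 * Real.pi = Real.pi by ring, zero_add] at h2
    rw [Real.circleAverage_def, h2] at h1
    have h3 : ((2 * Real.pi : ℝ) : ℂ) * f c = ∫ t in (-Real.pi)..Real.pi, f (circleMap c s t) := by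
      rw [← h1, Complex.real_smul, ← mul_assoc, ← Complex.ofReal_mul,
        mul_inv_cancel₀ (by positivity), Complex.ofReal_one, one_mul]
    have h4 : ENNReal.ofReal (2 * Real.pi) * ‖f c‖ₑ =
        ‖∫ t in (-Real.pi)..Real.pi, f (circleMap c s t)‖ₑ := by
      rw [← h3, enorm_mul]
      congr 1
      rw [← ofReal_norm, Complex.norm_real, Real.norm_of_nonneg (by positivity)]
    rw [h4, intervalIntegral.integral_of_le (by linarith [Real.pi_pos]),
      restrict_Ioo_eq_restrict_Ioc]
    exact enorm_integral_le_lintegral_enorm _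
  -- Extension by zero gives a measurable function on the whole plane, to which the polar change of
  -- variables applies.
  set F : ℂ → ℂ := (ball c r).piecewise f 0 with hF
  have hFm : Measurable F :=
    hf.continuousOn.measurable_piecewise continuousOn_const measurableSet_ball
  have hpol : ∀ s ∈ Ioi (0 : ℝ), ∀ t : ℝ, c + Complex.polarCoord.symm (s, t) = circleMap c s t := by
    intro s _ t
    rw [Complex.polarCoord_symm_apply, circleMap, Complex.exp_mul_I]
    simp
  calc ENNReal.ofReal (Real.pi * r ^ 2) * ‖f c‖ₑ
      = ∫⁻ s in Ioo 0 r, ENNReal.ofReal s * (ENNReal.ofReal (2 * Real.pi) * ‖f c‖ₑ) := by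
        rw [lintegral_mul_const _ (by fun_prop), ← ofReal_integral_eq_lintegral_ofReal]
        · rw [← integral_Ioc_eq_integral_Ioo, ← intervalIntegral.integral_of_le hr.le, integral_id,
            ← mul_assoc, ← ENNReal.ofReal_mul (by norm_num; positivity : (0 : ℝ) ≤ (r ^ 2 - 0 ^ 2) / 2)]
          congr 2
          ring
        · exact (continuous_id.integrableOn_Icc (a := 0) (b := r)).mono_set Ioo_subset_Icc_self
        · exact (ae_restrict_iff' measurableSet_Ioo).2 (.of_forall fun s hs => hs.1.le)
    _ ≤ ∫⁻ s in Ioo 0 r, ∫⁻ t in Ioo (-Real.pi) Real.pi,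
          ENNReal.ofReal s * ‖F (c + Complex.polarCoord.symm (s, t))‖ₑ := by
        refine setLIntegral_mono' measurableSet_Ioo fun s hs => ?_
        rw [lintegral_const_mul' _ _ ENNReal.ofReal_ne_top]
        gcongr
        refine (hcirc s hs).trans_eq (lintegral_congr fun t => ?_)
        rw [hpol s hs.1, hF, piecewise_eq_of_mem]
        simp [dist_eq_norm, abs_of_pos hs.1, hs.2]
    _ ≤ ∫⁻ s in Ioi 0, ∫⁻ t in Ioo (-Real.pi) Real.pi,
          ENNReal.ofReal s * ‖F (c + Complex.polarCoord.symm (s, t))‖ₑ :=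
        lintegral_mono_set Ioo_subset_Ioi_self
    _ = ∫⁻ w in polarCoord.target,
          ENNReal.ofReal w.1 • ‖F (c + Complex.polarCoord.symm w)‖ₑ := by
        rw [polarCoord_target, Measure.volume_eq_prod, ← Measure.prod_restrict, lintegral_prod]
        · rfl
        · have : Measurable fun w : ℝ × ℝ => Complex.polarCoord.symm w := by
            simp only [Complex.polarCoord_symm_apply]; fun_prop
          simp only [smul_eq_mul]
          fun_prop
    _ = ∫⁻ z, ‖F (c + z)‖ₑ := Complex.lintegral_comp_polarCoord_symm fun z => ‖F (c + z)‖ₑ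
    _ = ∫⁻ z, ‖F z‖ₑ := lintegral_add_left_eq_self (fun z => ‖F z‖ₑ) c
    _ = ∫⁻ z in ball c r, ‖f z‖ₑ := by
        rw [← lintegral_indicator measurableSet_ball]
        refine lintegral_congr fun z => ?_
        by_cases hz : z ∈ ball c r <;> simp [hF, hz]

-- Hölder against the constant 1 on the disc, applied to the case of |f|; the surplus factor v^(p-1)
-- cancels.
open Metric in
theorem enorm_rpow_center_le_of_one_lt {p : ℝ} (hp : 1 < p) {f : ℂ → ℂ} {c : ℂ} {r : ℝ} (hr : 0 < r)
    (hf : DifferentiableOn ℂ f (ball c r)) :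
    ‖f c‖ₑ ^ p * ENNReal.ofReal (Real.pi * r ^ 2) ≤ ∫⁻ z in ball c r, ‖f z‖ₑ ^ p := by
  have hp0 : 0 < p := by linarith
  set v := ENNReal.ofReal (Real.pi * r ^ 2) with hv
  have hv0 : v ≠ 0 := by
    rw [hv, Ne, ENNReal.ofReal_eq_zero, not_le]
    have := Real.pi_pos
    positivity
  have hvt : v ≠ ∞ := ENNReal.ofReal_ne_top
  have hvol : volume (ball c r) = v := by
    rw [Complex.volume_ball, hv, ENNReal.ofReal_mul Real.pi_pos.le, mul_comm,
      ENNReal.ofReal_pow hr.le]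
    congr 1
    rw [← NNReal.coe_real_pi, ENNReal.ofReal_coe_nnreal]
  have hpq := Real.HolderConjugate.conjExponent hp
  have hm : AEMeasurable (fun z => ‖f z‖ₑ) (volume.restrict (ball c r)) :=
    (hf.continuousOn.aestronglyMeasurable measurableSet_ball).enorm
  have h1 := ENNReal.lintegral_mul_le_Lp_mul_Lq (volume.restrict (ball c r)) hpq hm
    (aemeasurable_const (b := (1 : ℝ≥0∞)))
  simp only [Pi.mul_apply, mul_one, ENNReal.one_rpow, lintegral_const, one_mul,
    Measure.restrict_apply MeasurableSet.univ, univ_inter, hvol] at h1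
  have h2 := (enorm_center_le_lintegral_ball hr hf).trans h1
  have h3 := ENNReal.rpow_le_rpow h2 hp0.le
  rw [ENNReal.mul_rpow_of_nonneg _ _ hp0.le, ENNReal.mul_rpow_of_nonneg _ _ hp0.le,
    ← ENNReal.rpow_mul, ← ENNReal.rpow_mul, one_div_mul_cancel hp0.ne', ENNReal.rpow_one] at h3
  have h4 : 1 / p.conjExponent * p = p - 1 := by
    rw [Real.conjExponent]; field_simp
  rw [h4] at h3
  have h5 : v ^ p = v * v ^ (p - 1) := by
    nth_rw 2 [← ENNReal.rpow_one v]
    rw [← ENNReal.rpow_add _ _ hv0 hvt]; ring_nf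
  rw [h5, mul_right_comm, mul_comm v] at h3
  exact (ENNReal.mul_le_mul_iff_left (by simp [hv0, hvt]) (by
    exact ENNReal.rpow_ne_top_of_nonneg (by linarith) hvt)).1 h3

-- For p ≤ 1 Hölder goes the wrong way. Instead choose w maximizing (r/2 - |w - c|)² |f(w)|^p. Near
-- w, |f| is at most a constant times |f(w)|, so |f| = |f|^(1-p) |f|^p is at most a constant times
-- |f(w)|^(1-p) |f|^p. The inequality for |f| at w, divided by |f(w)|^(1-p), gives the claim at w,
-- and maximality carries it to c.
open Metric in
theorem enorm_rpow_center_le_of_le_one {p : ℝ} (hp : 0 < p) (hp1 : p ≤ 1) {f : ℂ → ℂ} {c : ℂ}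
    {r : ℝ} (hr : 0 < r) (hf : DifferentiableOn ℂ f (ball c r)) :
    ‖f c‖ₑ ^ p * ENNReal.ofReal (Real.pi * r ^ 2) ≤
      16 * ((4 : ℝ≥0∞) ^ (1 / p)) ^ (1 - p) * ∫⁻ z in ball c r, ‖f z‖ₑ ^ p := by
  rcases eq_or_ne (f c) 0 with h0 | h0
  · simp [h0, hp]
  have hcont : ContinuousOn (fun w => (r / 2 - dist w c) ^ 2 * ‖f w‖ ^ p) (closedBall c (r / 2)) := by
    have h1 : ContinuousOn f (closedBall c (r / 2)) :=
      hf.continuousOn.mono (closedBall_subset_ball (by linarith))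
    exact (by fun_prop : Continuous fun w : ℂ => (r / 2 - dist w c) ^ 2).continuousOn.mul
      (h1.norm.rpow_const fun _ _ => Or.inr hp.le)
  obtain ⟨w, hw, hmax⟩ := (isCompact_closedBall c (r / 2)).exists_isMaxOn
    ⟨c, mem_closedBall_self (by linarith)⟩ hcont
  have hmax' : ∀ u ∈ closedBall c (r / 2), (r / 2 - dist u c) ^ 2 * ‖f u‖ ^ p ≤
      (r / 2 - dist w c) ^ 2 * ‖f w‖ ^ p := fun u hu => hmax hu
  have hc := hmax' c (mem_closedBall_self (by linarith))
  rw [dist_self, sub_zero] at hc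
  have hcpos : 0 < (r / 2) ^ 2 * ‖f c‖ ^ p := by
    have := norm_pos_iff.2 h0
    positivity
  set d := r / 2 - dist w c with hd
  have hd0 : 0 < d := by
    rcases eq_or_lt_of_le (sub_nonneg.2 (mem_closedBall.1 hw)) with h | h
    · rw [← hd] at h
      rw [← h] at hc
      norm_num at hc
      linarith
    · exact h
  have hw0 : f w ≠ 0 := by
    intro h
    rw [h, norm_zero, Real.zero_rpow hp.ne', mul_zero] at hc
    linarith
  have hsub : ball w (d / 2) ⊆ ball c r := by
    refine ball_subset_ball' ?_
    linarith [dist_nonneg (x := w) (y := c)]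
  have hbd : ∀ u ∈ ball w (d / 2), ‖f u‖ ≤ 4 ^ (1 / p) * ‖f w‖ := by
    intro u hu
    have h1 : d / 2 ≤ r / 2 - dist u c := by
      linarith [dist_triangle u w c, mem_ball.1 hu]
    have h2 := hmax' u (mem_closedBall.2 (by linarith))
    have h3 : ‖f u‖ ^ p ≤ 4 * ‖f w‖ ^ p := by
      have h4 : (d / 2) ^ 2 * ‖f u‖ ^ p ≤ d ^ 2 * ‖f w‖ ^ p :=
        le_trans (by gcongr) h2
      have h5 : 0 < d ^ 2 := by positivity
      have h6 : d ^ 2 * (‖f u‖ ^ p) ≤ d ^ 2 * (4 * ‖f w‖ ^ p) := by linarith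
      exact le_of_mul_le_mul_left h6 h5
    have h7 := Real.rpow_le_rpow (by positivity) h3 (by positivity : 0 ≤ 1 / p)
    rwa [Real.mul_rpow (by norm_num) (by positivity), ← Real.rpow_mul (norm_nonneg _),
      ← Real.rpow_mul (norm_nonneg _), mul_one_div_cancel hp.ne', Real.rpow_one,
      Real.rpow_one] at h7
  have hbde : ∀ u ∈ ball w (d / 2), ‖f u‖ₑ ≤
      (4 ^ (1 / p) * ‖f w‖ₑ) ^ (1 - p) * ‖f u‖ₑ ^ p := by
    intro u hu
    rcases eq_or_ne (f u) 0 with h | h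
    · simp [h]
    · have h1 : ‖f u‖ₑ ≤ 4 ^ (1 / p) * ‖f w‖ₑ := by
        have h2 := ENNReal.ofReal_le_ofReal (hbd u hu)
        rwa [ENNReal.ofReal_mul (by positivity), ofReal_norm, ofReal_norm,
          ← ENNReal.ofReal_rpow_of_pos (by norm_num), ENNReal.ofReal_ofNat] at h2
      calc ‖f u‖ₑ = ‖f u‖ₑ ^ (1 - p) * ‖f u‖ₑ ^ p := by
            rw [← ENNReal.rpow_add _ _ (by simpa using h) enorm_ne_top]
            simp
        _ ≤ _ := by
            gcongr
  have hA0 : ‖f w‖ₑ ≠ 0 := by simpa using hw0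
  have hAt : ‖f w‖ₑ ≠ ∞ := enorm_ne_top
  have h1 := enorm_center_le_lintegral_ball (by positivity) (hf.mono hsub)
  have h2 : ∫⁻ u in ball w (d / 2), ‖f u‖ₑ ≤
      (4 ^ (1 / p) * ‖f w‖ₑ) ^ (1 - p) * ∫⁻ z in ball c r, ‖f z‖ₑ ^ p := by
    calc _ ≤ ∫⁻ u in ball w (d / 2), (4 ^ (1 / p) * ‖f w‖ₑ) ^ (1 - p) * ‖f u‖ₑ ^ p :=
          setLIntegral_mono' measurableSet_ball hbde
      _ = (4 ^ (1 / p) * ‖f w‖ₑ) ^ (1 - p) * ∫⁻ u in ball w (d / 2), ‖f u‖ₑ ^ p := by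
          refine lintegral_const_mul' _ _ (ENNReal.rpow_ne_top_of_nonneg (by linarith) ?_)
          exact ENNReal.mul_ne_top (ENNReal.rpow_ne_top_of_nonneg (by positivity) (by simp)) hAt
      _ ≤ _ := by
          gcongr
  have h3 : ‖f w‖ₑ ^ p * ENNReal.ofReal (Real.pi * (d / 2) ^ 2) ≤
      ((4 : ℝ≥0∞) ^ (1 / p)) ^ (1 - p) * ∫⁻ z in ball c r, ‖f z‖ₑ ^ p := by
    have h4 := mul_le_mul_right (h1.trans h2) (‖f w‖ₑ ^ (p - 1))
    rw [ENNReal.mul_rpow_of_nonneg _ _ (by linarith : 0 ≤ 1 - p)] at h4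
    have e1 : ‖f w‖ₑ ^ (p - 1) * ‖f w‖ₑ ^ (1 - p) = 1 := by
      rw [← ENNReal.rpow_add _ _ hA0 hAt]; simp
    have e2 : ‖f w‖ₑ ^ (p - 1) * ‖f w‖ₑ = ‖f w‖ₑ ^ p := by
      nth_rw 2 [← ENNReal.rpow_one ‖f w‖ₑ]
      rw [← ENNReal.rpow_add _ _ hA0 hAt]; simp
    calc _ = ‖f w‖ₑ ^ (p - 1) * (ENNReal.ofReal (Real.pi * (d / 2) ^ 2) * ‖f w‖ₑ) := by
          rw [← e2]; ring
      _ ≤ _ := h4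
      _ = (‖f w‖ₑ ^ (p - 1) * ‖f w‖ₑ ^ (1 - p)) *
          (((4 : ℝ≥0∞) ^ (1 / p)) ^ (1 - p) * ∫⁻ z in ball c r, ‖f z‖ₑ ^ p) := by ring
      _ = _ := by rw [e1, one_mul]
  -- Maximality at w against c; 16 = 4 · 4 comes from halving both r and d.
  have h5 : ‖f c‖ₑ ^ p * ENNReal.ofReal (Real.pi * r ^ 2) ≤
      16 * (‖f w‖ₑ ^ p * ENNReal.ofReal (Real.pi * (d / 2) ^ 2)) := by
    have h6 : ∀ x : ℂ, ‖x‖ₑ ^ p = ENNReal.ofReal (‖x‖ ^ p) := fun x => by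
      rw [← ofReal_norm, ENNReal.ofReal_rpow_of_nonneg (norm_nonneg _) hp.le]
    rw [h6, h6, ← ENNReal.ofReal_mul (by positivity), ← ENNReal.ofReal_mul (by positivity),
      ← ENNReal.ofReal_ofNat, ← ENNReal.ofReal_mul (by norm_num)]
    refine ENNReal.ofReal_le_ofReal ?_
    have := mul_le_mul_of_nonneg_left hc Real.pi_pos.le
    linarith
  calc _ ≤ _ := h5
    _ ≤ 16 * (((4 : ℝ≥0∞) ^ (1 / p)) ^ (1 - p) * ∫⁻ z in ball c r, ‖f z‖ₑ ^ p) := by gcongr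
    _ = _ := by ring

theorem setLIntegral_areaMeasure (s : Set ℂ) (g : ℂ → ℝ≥0∞) :
    ∫⁻ z in s, g z ∂areaMeasure = (ENNReal.ofReal Real.pi)⁻¹ * ∫⁻ z in s, g z := by
  rw [areaMeasure, Measure.restrict_smul, lintegral_smul_measure, smul_eq_mul]

open Metric in
/-- The sub-mean value inequality for `|f|^p`, `0 < p < ∞`. -/
theorem exists_enorm_rpow_center_le {p : ℝ} (hp : 0 < p) :
    ∃ C : ℝ≥0, ∀ (f : ℂ → ℂ) (c : ℂ) (r : ℝ), 0 < r → DifferentiableOn ℂ f (ball c r) →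
      ‖f c‖ₑ ^ p * ENNReal.ofReal (r ^ 2) ≤ C * ∫⁻ z in ball c r, ‖f z‖ₑ ^ p ∂areaMeasure := by
  have hpi0 : ENNReal.ofReal Real.pi ≠ 0 := by simp [Real.pi_pos]
  obtain ⟨C, hC⟩ : ∃ C : ℝ≥0, ∀ (f : ℂ → ℂ) (c : ℂ) (r : ℝ), 0 < r →
      DifferentiableOn ℂ f (ball c r) →
      ‖f c‖ₑ ^ p * ENNReal.ofReal (Real.pi * r ^ 2) ≤ C * ∫⁻ z in ball c r, ‖f z‖ₑ ^ p := by
    rcases lt_or_ge 1 p with h | h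
    · exact ⟨1, fun f c r hr hf => by simpa using enorm_rpow_center_le_of_one_lt h hr hf⟩
    · have hfin : 16 * ((4 : ℝ≥0∞) ^ (1 / p)) ^ (1 - p) ≠ ∞ :=
        ENNReal.mul_ne_top (by simp) (ENNReal.rpow_ne_top_of_nonneg (by linarith)
          (ENNReal.rpow_ne_top_of_nonneg (by positivity) (by simp)))
      refine ⟨(16 * ((4 : ℝ≥0∞) ^ (1 / p)) ^ (1 - p)).toNNReal, fun f c r hr hf => ?_⟩
      rw [ENNReal.coe_toNNReal hfin]
      exact enorm_rpow_center_le_of_le_one hp h hr hf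
  refine ⟨C, fun f c r hr hf => ?_⟩
  have h := mul_le_mul_right (hC f c r hr hf) (ENNReal.ofReal Real.pi)⁻¹
  rw [setLIntegral_areaMeasure]
  calc _ = (ENNReal.ofReal Real.pi)⁻¹ * ENNReal.ofReal Real.pi *
        (‖f c‖ₑ ^ p * ENNReal.ofReal (r ^ 2)) := by
        rw [ENNReal.inv_mul_cancel hpi0 ENNReal.ofReal_ne_top, one_mul]
    _ = (ENNReal.ofReal Real.pi)⁻¹ * (‖f c‖ₑ ^ p * ENNReal.ofReal (Real.pi * r ^ 2)) := by
        rw [ENNReal.ofReal_mul Real.pi_pos.le]; ring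
    _ ≤ _ := h
    _ = _ := by ring

/-! ### The unit disc, radial growth and Montel's theorem -/

theorem isOpen_unitDisc : IsOpen unitDisc := Metric.isOpen_ball

theorem mem_unitDisc {z : ℂ} : z ∈ unitDisc ↔ ‖z‖ < 1 := by simp [unitDisc]

theorem ball_subset_unitDisc {z : ℂ} {r : ℝ} (h : r ≤ 1 - ‖z‖) : Metric.ball z r ⊆ unitDisc :=
  Metric.ball_subset_ball' (by rw [dist_zero_right]; linarith)

/-- Growth of an analytic function along a radius, from a power bound for its derivative. -/
theorem norm_radial_sub_le {f : ℂ → ℂ} (hf : DifferentiableOn ℂ f unitDisc) {ζ : ℂ} (hζ : ‖ζ‖ = 1)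
    {a b ε M : ℝ} (ha : 0 ≤ a) (hab : a ≤ b) (hb : b < 1) (hε : 0 < ε) (hM : 0 ≤ M)
    (h : ∀ t ∈ Icc a b, ‖deriv f (t * ζ)‖ ≤ M * (1 - t) ^ (-1 - ε)) :
    ‖f (b * ζ) - f (a * ζ)‖ ≤ M / ε * (1 - b) ^ (-ε) := by
  have hmem : ∀ t ∈ Icc a b, (t * ζ : ℂ) ∈ unitDisc := by
    intro t ht
    rw [mem_unitDisc, norm_mul, hζ, mul_one, Complex.norm_real, Real.norm_of_nonneg (ha.trans ht.1)]
    linarith [ht.2]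
  have hder : ∀ t ∈ Icc a b, HasDerivAt (fun t : ℝ => f (t * ζ) - f (a * ζ))
      (deriv f (t * ζ) * ζ) t := by
    intro t ht
    have h1 : HasDerivAt f (deriv f (t * ζ)) (t * ζ) :=
      (hf.differentiableAt (isOpen_unitDisc.mem_nhds (hmem t ht))).hasDerivAt
    have h2 : HasDerivAt (fun w : ℂ => w * ζ) ζ (t : ℂ) := by
      simpa using (hasDerivAt_id (t : ℂ)).mul_const ζ
    exact (HasDerivAt.comp_ofReal (h1.comp (t : ℂ) h2)).sub_const _
  -- The comparison function is the antiderivative of the derivative bound that vanishes at a.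
  have hBder : ∀ t ∈ Icc a b, HasDerivAt
      (fun t : ℝ => M / ε * (1 - t) ^ (-ε) - M / ε * (1 - a) ^ (-ε)) (M * (1 - t) ^ (-1 - ε)) t := by
    intro t ht
    have h1 : HasDerivAt (fun t : ℝ => 1 - t) (-1) t := by
      simpa using (hasDerivAt_id t).const_sub 1
    have h2 := ((h1.rpow_const (p := -ε) (Or.inl (by linarith [ht.2]))).const_mul (M / ε)).sub_const
      (M / ε * (1 - a) ^ (-ε))
    have h3 : M * (1 - t) ^ (-1 - ε) = M / ε * (-1 * -ε * (1 - t) ^ (-ε - 1)) := by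
      rw [show -1 - ε = -ε - 1 by ring]
      field_simp
    rw [h3]
    exact h2
  have key := image_norm_le_of_norm_deriv_right_le_deriv_boundary'
    (f := fun t : ℝ => f (t * ζ) - f (a * ζ)) (f' := fun t => deriv f (t * ζ) * ζ)
    (a := a) (b := b)
    (fun t ht => (hder t ht).continuousAt.continuousWithinAt)
    (fun t ht => (hder t (Ico_subset_Icc_self ht)).hasDerivWithinAt)
    (B := fun t : ℝ => M / ε * (1 - t) ^ (-ε) - M / ε * (1 - a) ^ (-ε))
    (B' := fun t => M * (1 - t) ^ (-1 - ε))
    (by simp) (fun t ht => (hBder t ht).continuousAt.continuousWithinAt)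
    (fun t ht => (hBder t (Ico_subset_Icc_self ht)).hasDerivWithinAt)
    (fun t ht => by
      rw [norm_mul, hζ, mul_one]
      exact h t (Ico_subset_Icc_self ht)) (right_mem_Icc.2 hab)
  refine key.trans (sub_le_self _ ?_)
  have : 0 < 1 - a := by linarith
  positivity

open Metric in
/-- **Montel's theorem** on the unit disc: a sequence of analytic functions that is uniformly
bounded on every smaller disc has a locally uniformly convergent subsequence. -/
theorem exists_subseq_tendstoLocallyUniformlyOn {f : ℕ → ℂ → ℂ}
    (hf : ∀ n, DifferentiableOn ℂ (f n) unitDisc) {M : ℝ → ℝ}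
    (hM : ∀ r < 1, ∀ n z, ‖z‖ ≤ r → ‖f n z‖ ≤ M r) :
    ∃ g : ℂ → ℂ, DifferentiableOn ℂ g unitDisc ∧ ∃ φ : ℕ → ℕ, StrictMono φ ∧
      TendstoLocallyUniformlyOn (fun n => f (φ n)) g atTop unitDisc := by
  -- With a third of the distance to the circle, a disc of radius ρ about any point within ρ of x
  -- stays in |u| ≤ 1 - ρ, so Cauchy's estimate bounds the derivatives uniformly in n.
  set ρ : unitDisc → ℝ := fun x => (1 - ‖(x : ℂ)‖) / 3 with hρ
  have hx1 : ∀ x : unitDisc, ‖(x : ℂ)‖ < 1 := fun x => mem_unitDisc.1 x.2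
  have hρ0 : ∀ x, 0 < ρ x := fun x => by have := hx1 x; simp only [hρ]; linarith
  set L : unitDisc → ℝ := fun x => M (1 - ρ x) / ρ x with hL
  have hLip : ∀ n (x y : unitDisc), dist y x < ρ x → ‖f n y - f n x‖ ≤ L x * ‖(y - x : ℂ)‖ := by
    intro n x y hxy
    have hsub : ∀ w ∈ ball (x : ℂ) (ρ x), ∀ u ∈ closedBall w (ρ x), ‖u‖ ≤ 1 - ρ x := by
      intro w hw u hu
      have h1 := dist_triangle u w 0
      have h2 := dist_triangle w x 0
      rw [dist_zero_right, dist_zero_right] at *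
      have h3 := mem_ball.1 hw
      have h4 := mem_closedBall.1 hu
      have h5 : ‖(x : ℂ)‖ = 1 - 3 * ρ x := by simp only [hρ]; ring
      linarith
    have hlt : 1 - ρ x < 1 := by linarith [hρ0 x]
    have hsub' : ∀ w ∈ ball (x : ℂ) (ρ x), closedBall w (ρ x) ⊆ unitDisc :=
      fun w hw u hu => mem_unitDisc.2 ((hsub w hw u hu).trans_lt hlt)
    refine (convex_ball (x : ℂ) (ρ x)).norm_image_sub_le_of_norm_deriv_le (𝕜 := ℂ)
      (fun w hw => (hf n).differentiableAt (isOpen_unitDisc.mem_nhds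
        (hsub' w hw (mem_closedBall_self (hρ0 x).le)))) (fun w hw => ?_)
      (mem_ball_self (hρ0 x)) (mem_ball.2 hxy)
    exact Complex.norm_deriv_le_of_forall_mem_sphere_norm_le (hρ0 x)
      ((hf n).diffContOnCl_ball (hsub' w hw))
      fun u hu => hM _ hlt n u (hsub w hw u (sphere_subset_closedBall hu))
  -- Both bounds are closed under pointwise limits. The functions satisfying `P` therefore form a
  -- compact set in the product topology, which is the form of Arzelà–Ascoli used here.
  set P : (unitDisc → ℂ) → Prop := fun F => (∀ x, ‖F x‖ ≤ M ‖(x : ℂ)‖) ∧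
    ∀ x y : unitDisc, dist y x < ρ x → ‖F y - F x‖ ≤ L x * ‖(y - x : ℂ)‖ with hP
  have hLcont : ∀ x, ∀ ε > 0, ∃ δ > 0, ∀ y, dist y x < δ → ∀ F, P F → dist (F x) (F y) < ε := by
    intro x ε hε
    refine ⟨min (ρ x) (ε / (|L x| + 1)), lt_min (hρ0 x) (by positivity), fun y hy F hF => ?_⟩
    have h1 := hF.2 x y (hy.trans_le (min_le_left _ _))
    have h2 : dist y x < ε / (|L x| + 1) := hy.trans_le (min_le_right _ _)
    rw [lt_div_iff₀ (by positivity)] at h2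
    have h3 : dist y x = ‖(y - x : ℂ)‖ := by rw [Subtype.dist_eq, dist_eq_norm]
    rw [dist_comm, dist_eq_norm]
    rw [h3] at h2
    nlinarith [le_abs_self (L x), norm_nonneg (y - x : ℂ)]
  have hcontP : ∀ F, P F → Continuous F := fun F hF => Metric.continuous_iff.2 fun x ε hε => by
    obtain ⟨δ, hδ, h⟩ := hLcont x ε hε
    exact ⟨δ, hδ, fun y hy => by rw [dist_comm]; exact h y hy F hF⟩
  set S : Set C(unitDisc, ℂ) := {F | P F} with hS
  have himg : ContinuousMap.toFun '' S = {F | P F} := by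
    ext F
    constructor
    · rintro ⟨G, hG, rfl⟩
      exact hG
    · exact fun hF => ⟨⟨F, hcontP F hF⟩, hF, rfl⟩
  have hScomp : IsCompact S := by
    refine ArzelaAscoli.isCompact_of_equicontinuous S ?_ ?_
    · rw [himg]
      refine (isCompact_univ_pi fun x : unitDisc =>
        isCompact_closedBall (0 : ℂ) (M ‖(x : ℂ)‖)).of_isClosed_subset ?_ ?_
      · have : {F : unitDisc → ℂ | P F} = (⋂ x : unitDisc, {F | ‖F x‖ ≤ M ‖(x : ℂ)‖}) ∩
            ⋂ (x : unitDisc) (y : unitDisc) (_ : dist y x < ρ x),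
              {F | ‖F y - F x‖ ≤ L x * ‖(y - x : ℂ)‖} := by
          ext F
          simp [hP]
        rw [this]
        refine IsClosed.inter (isClosed_iInter fun x => ?_)
          (isClosed_iInter fun x => isClosed_iInter fun y => isClosed_iInter fun _ => ?_)
        · exact isClosed_le (continuous_apply x).norm continuous_const
        · exact isClosed_le ((continuous_apply y).sub (continuous_apply x)).norm continuous_const
      · intro F hF x _
        simpa using hF.1 x
    · intro x
      rw [Metric.equicontinuousAt_iff]
      intro ε hε
      obtain ⟨δ, hδ, h⟩ := hLcont x ε hε
      exact ⟨δ, hδ, fun y hy F => h y hy _ F.2⟩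
  have hfP : ∀ n, P fun x => f n x := fun n => ⟨fun x => hM _ (hx1 x) n x le_rfl, hLip n⟩
  have : LocallyCompactSpace unitDisc := isOpen_unitDisc.locallyCompactSpace
  obtain ⟨G, -, φ, hφ, hG⟩ := hScomp.tendsto_subseq
    (x := fun n => (⟨fun x => f n x, hcontP _ (hfP n)⟩ : C(unitDisc, ℂ))) fun n => hfP n
  rw [ContinuousMap.tendsto_iff_tendstoLocallyUniformly] at hG
  classical
  set g : ℂ → ℂ := fun z => if h : z ∈ unitDisc then G ⟨z, h⟩ else 0 with hg
  have hloc : TendstoLocallyUniformlyOn (fun n => f (φ n)) g atTop unitDisc := by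
    rw [tendstoLocallyUniformlyOn_iff_tendstoLocallyUniformly_comp_coe]
    have hgG : g ∘ Subtype.val = G := by
      ext x
      simp [hg]
    rw [hgG]
    exact hG
  exact ⟨g, hloc.differentiableOn (.of_forall fun n => hf _) isOpen_unitDisc, φ, hφ, hloc⟩

/-! ### Integrals over geometric level sets -/

theorem rpow_le_of_comparable {x y c : ℝ} (α : ℝ) (hx : 0 < x) (hc : 0 < c) (hxy : x ≤ c * y)
    (hyx : y ≤ c * x) : x ^ α ≤ c ^ |α| * y ^ α := by
  have hy : 0 < y := pos_of_mul_pos_right (hx.trans_le hxy) hc.le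
  rcases le_total 0 α with h | h
  · rw [abs_of_nonneg h, ← Real.mul_rpow hc.le hy.le]
    exact Real.rpow_le_rpow hx.le hxy h
  · calc x ^ α ≤ (y / c) ^ α :=
          Real.rpow_le_rpow_of_nonpos (by positivity) (by rwa [div_le_iff₀' hc]) h
      _ = c ^ |α| * y ^ α := by
          rw [Real.div_rpow hy.le hc.le, abs_of_nonpos h, Real.rpow_neg hc.le]
          ring

/-- Integration of a negative power over geometric level sets. -/
theorem exists_lintegral_rpow_neg_le {ρ a b : ℝ} (hρ : 0 < ρ) (hab : ρ ^ (a - b) < 1) :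
    ∃ C : ℝ≥0, ∀ (ν : Measure ℂ) (E : Set ℂ) (g : ℂ → ℝ) (h : ℝ) (M : ℝ≥0∞), 0 < h →
      MeasurableSet E → Measurable g →
      (∀ z ∈ E, ∃ k : ℕ, ρ ^ k * h / 2 ≤ g z ∧ g z ≤ ρ ^ k * h) →
      (∀ k : ℕ, ν (E ∩ {z | g z ≤ ρ ^ k * h}) ≤ M * ENNReal.ofReal ((ρ ^ k * h) ^ a)) →
      ∫⁻ z in E, ENNReal.ofReal (g z ^ (-b)) ∂ν ≤ C * M * ENNReal.ofReal (h ^ (a - b)) := by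
  have hgeo : (1 - ENNReal.ofReal (ρ ^ (a - b)))⁻¹ ≠ ∞ := by
    rw [ENNReal.inv_ne_top, Ne, tsub_eq_zero_iff_le, not_le]
    simpa using hab
  refine ⟨(ENNReal.ofReal (2 ^ |b|) * (1 - ENNReal.ofReal (ρ ^ (a - b)))⁻¹).toNNReal,
    fun ν E g h M hh hE hg hscale hmeas => ?_⟩
  rw [ENNReal.coe_toNNReal (ENNReal.mul_ne_top ENNReal.ofReal_ne_top hgeo)]
  have ht : ∀ k : ℕ, 0 < ρ ^ k * h := fun k => by positivity
  -- Whole sublevel sets replace the layers g ≈ ρ^k h. The overcounting is harmless, since the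
  -- resulting series is geometric with ratio ρ^(a-b) < 1.
  set A : ℕ → Set ℂ := fun k => E ∩ {z | g z ≤ ρ ^ k * h} with hA
  have hAm : ∀ k, MeasurableSet (A k) := fun k => hE.inter (measurableSet_le hg measurable_const)
  set c : ℕ → ℝ≥0∞ := fun k => ENNReal.ofReal (2 ^ |b| * (ρ ^ k * h) ^ (-b)) with hc
  calc ∫⁻ z in E, ENNReal.ofReal (g z ^ (-b)) ∂ν
      ≤ ∫⁻ z in E, ∑' k, (A k).indicator (fun _ => c k) z ∂ν := by
        refine setLIntegral_mono' hE fun z hz => ?_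
        obtain ⟨k, hk1, hk2⟩ := hscale z hz
        refine le_trans ?_ (ENNReal.le_tsum k)
        rw [indicator_of_mem (show z ∈ A k from ⟨hz, hk2⟩)]
        rw [hc, ← abs_neg b]
        exact ENNReal.ofReal_le_ofReal (rpow_le_of_comparable (-b)
          (by linarith [ht k]) two_pos (by linarith [ht k]) (by linarith))
    _ = ∑' k, ∫⁻ z in E, (A k).indicator (fun _ => c k) z ∂ν :=
        lintegral_tsum fun k => (measurable_const.indicator (hAm k)).aemeasurable
    _ ≤ ∑' k, ENNReal.ofReal (2 ^ |b|) * M * ENNReal.ofReal (h ^ (a - b)) *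
          ENNReal.ofReal (ρ ^ (a - b)) ^ k := by
        refine ENNReal.tsum_le_tsum fun k => ?_
        rw [lintegral_indicator_const (hAm k)]
        have h1 : (ν.restrict E) (A k) ≤ M * ENNReal.ofReal ((ρ ^ k * h) ^ a) :=
          (Measure.restrict_apply_le _ _).trans (hmeas k)
        have h2 : 2 ^ |b| * (ρ ^ k * h) ^ (-b) * (ρ ^ k * h) ^ a =
            2 ^ |b| * h ^ (a - b) * (ρ ^ (a - b)) ^ k := by
          rw [mul_assoc, ← Real.rpow_add (ht k), mul_assoc, show -b + a = a - b by ring,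
            Real.mul_rpow (by positivity) hh.le, ← Real.rpow_natCast, ← Real.rpow_natCast,
            ← Real.rpow_mul hρ.le, ← Real.rpow_mul hρ.le, mul_comm (k : ℝ), mul_comm (ρ ^ _)]
        calc c k * (ν.restrict E) (A k)
            ≤ c k * (M * ENNReal.ofReal ((ρ ^ k * h) ^ a)) := by gcongr
          _ = M * ENNReal.ofReal (2 ^ |b| * (ρ ^ k * h) ^ (-b) * (ρ ^ k * h) ^ a) := by
              have := ht k
              rw [ENNReal.ofReal_mul (p := 2 ^ |b| * (ρ ^ k * h) ^ (-b)) (by positivity)]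
              ring
          _ = _ := by
              rw [h2, ENNReal.ofReal_mul (by positivity), ENNReal.ofReal_mul (by positivity),
                ENNReal.ofReal_pow (by positivity)]
              ring
    _ = _ := by
        rw [ENNReal.tsum_mul_left, ENNReal.tsum_geometric]
        ring

/-! ### The Carleson condition on discs centred on the circle -/

open Metric in
/-- The Carleson condition of order `s` with constant `K`, in terms of discs centred on the unit
circle. -/
def IsBallCarleson (s : ℝ) (K : ℝ≥0) (ν : Measure ℂ) : Prop :=
  ∀ ζ : ℂ, ‖ζ‖ = 1 → ∀ h : ℝ, 0 < h → ν (ball ζ h ∩ unitDisc) ≤ K * ENNReal.ofReal (h ^ s)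

theorem norm_exp_mul_I_sub_le (s t : ℝ) :
    ‖Complex.exp (s * Complex.I) - Complex.exp (t * Complex.I)‖ ≤ |s - t| := by
  have h : Complex.exp (s * Complex.I) - Complex.exp (t * Complex.I) =
      Complex.exp (t * Complex.I) * (Complex.exp (Complex.I * (s - t : ℝ)) - 1) := by
    rw [mul_sub, ← Complex.exp_add, mul_one]
    congr 2
    push_cast
    ring
  rw [h, norm_mul, Complex.norm_exp_ofReal_mul_I, one_mul]
  exact Real.norm_exp_I_mul_ofReal_sub_one_le

/-- After rotation by -θ the angle is the principal argument. Projecting radially to the circle at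
most doubles the distance to 1, and Jordan's inequality |sin(x/2)| ≥ |x|/π compares chord with arc.
-/
theorem exists_angle {z : ℂ} (hz : z ∈ unitDisc) (θ : ℝ) :
    ∃ φ : ℝ, |φ| ≤ Real.pi ∧ |φ| ≤ Real.pi * ‖z - Complex.exp (θ * Complex.I)‖ ∧
      z = ‖z‖ * Complex.exp ((θ + φ : ℝ) * Complex.I) := by
  set w := z * Complex.exp (-(θ * Complex.I)) with hw
  have hnorm : ‖w‖ = ‖z‖ := by
    rw [hw, norm_mul, show -(θ * Complex.I) = ((-θ : ℝ) : ℂ) * Complex.I by push_cast; ring,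
      Complex.norm_exp_ofReal_mul_I, mul_one]
  have hpolar := Complex.norm_mul_exp_arg_mul_I w
  refine ⟨w.arg, Complex.abs_arg_le_pi w, ?_, ?_⟩
  · have hdist : ‖w - 1‖ = ‖z - Complex.exp (θ * Complex.I)‖ := by
      have : w - 1 = (z - Complex.exp (θ * Complex.I)) * Complex.exp (-(θ * Complex.I)) := by
        rw [sub_mul, ← Complex.exp_add, add_neg_cancel, Complex.exp_zero]
      rw [this, norm_mul, show -(θ * Complex.I) = ((-θ : ℝ) : ℂ) * Complex.I by push_cast; ring,
        Complex.norm_exp_ofReal_mul_I, mul_one]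
    rw [← hdist]
    have h1 : ‖Complex.exp (Complex.I * w.arg) - 1‖ ≤ 2 * ‖w - 1‖ := by
      have h2 : ‖Complex.exp (Complex.I * w.arg) - w‖ = 1 - ‖w‖ := by
        nth_rw 2 [← hpolar]
        rw [mul_comm Complex.I, ← one_sub_mul, norm_mul, Complex.norm_exp_ofReal_mul_I, mul_one,
          ← Complex.ofReal_one, ← Complex.ofReal_sub, Complex.norm_real, Real.norm_of_nonneg]
        rw [hnorm]
        linarith [mem_unitDisc.1 hz]
      have h3 : 1 - ‖w‖ ≤ ‖w - 1‖ := by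
        have := norm_sub_norm_le (1 : ℂ) w
        rwa [norm_one, norm_sub_rev] at this
      linarith [norm_sub_le_norm_sub_add_norm_sub (Complex.exp (Complex.I * w.arg)) w 1]
    rw [Complex.norm_exp_I_mul_ofReal_sub_one, norm_mul, Real.norm_ofNat, Real.norm_eq_abs] at h1
    have h4 : 2 / Real.pi * (|w.arg| / 2) ≤ |Real.sin (w.arg / 2)| := by
      refine (Real.mul_le_sin (by positivity) ?_).trans ?_
      · linarith [Complex.abs_arg_le_pi w]
      · rcases abs_cases w.arg with ⟨h, _⟩ | ⟨h, _⟩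
        · rw [h]
          exact le_abs_self _
        · rw [h, neg_div, Real.sin_neg]
          exact neg_le_abs _
    have h5 : 2 / Real.pi * (|w.arg| / 2) = |w.arg| / Real.pi := by ring
    rw [h5, div_le_iff₀ Real.pi_pos] at h4
    nlinarith [Real.pi_pos]
  · rw [← hnorm]
    push_cast
    rw [add_mul, Complex.exp_add, mul_left_comm, hpolar, hw, mul_left_comm, ← Complex.exp_add,
      add_neg_cancel, Complex.exp_zero, mul_one]

-- The constant π of `exists_angle` is exactly the half-angle of an arc of unit normalized length,
-- so no constant is lost.
open Metric in
theorem ball_inter_unitDisc_subset_carlesonSquare (θ : ℝ) {h : ℝ} :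
    ball (Complex.exp (θ * Complex.I)) h ∩ unitDisc ⊆ carlesonSquare θ h := by
  rintro z ⟨hz, hzD⟩
  obtain ⟨φ, -, hφ, hzφ⟩ := exists_angle hzD θ
  rw [mem_ball, dist_eq_norm] at hz
  refine ⟨‖z‖, _, ⟨θ + φ, ?_, rfl⟩, ?_, mem_unitDisc.1 hzD, hzφ⟩
  · have := abs_le.1 (hφ.trans (mul_le_mul_of_nonneg_left hz.le Real.pi_pos.le))
    constructor <;> linarith [this.1, this.2]
  · have := norm_sub_norm_le (Complex.exp (θ * Complex.I)) z
    rw [Complex.norm_exp_ofReal_mul_I, norm_sub_rev] at this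
    linarith

theorem carlesonSquare_one (θ : ℝ) : carlesonSquare θ 1 = unitDisc := by
  ext z
  constructor
  · rintro ⟨r, ζ, ⟨t, -, rfl⟩, h1, h2, rfl⟩
    rw [mem_unitDisc, norm_mul, Complex.norm_exp_ofReal_mul_I, Complex.norm_real,
      Real.norm_of_nonneg (by linarith)]
    linarith
  · intro hz
    obtain ⟨φ, hφ, -, hzφ⟩ := exists_angle hz θ
    refine ⟨‖z‖, _, ⟨θ + φ, ?_, rfl⟩, by simp, mem_unitDisc.1 hz, hzφ⟩
    have := abs_le.1 hφ
    constructor <;> linarith [this.1, this.2]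

theorem carlesonSquare_subset_unitDisc (θ : ℝ) {ℓ : ℝ} (hℓ : ℓ ≤ 1) :
    carlesonSquare θ ℓ ⊆ unitDisc := by
  rintro z ⟨r, ζ, ⟨t, -, rfl⟩, h1, h2, rfl⟩
  rw [mem_unitDisc, norm_mul, Complex.norm_exp_ofReal_mul_I, Complex.norm_real,
    Real.norm_of_nonneg (by linarith)]
  linarith

theorem dist_lt_of_mem_carlesonSquare {θ ℓ : ℝ} (hℓ : 0 < ℓ) {z : ℂ}
    (hz : z ∈ carlesonSquare θ ℓ) : dist z (Complex.exp (θ * Complex.I)) < 6 * ℓ := by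
  obtain ⟨r, ζ, ⟨t, ht, rfl⟩, h1, h2, rfl⟩ := hz
  rw [dist_eq_norm]
  have e1 : ‖(r : ℂ) * Complex.exp (t * Complex.I) - Complex.exp (t * Complex.I)‖ = 1 - r := by
    rw [← sub_one_mul, norm_mul, Complex.norm_exp_ofReal_mul_I, mul_one, ← Complex.ofReal_one,
      ← Complex.ofReal_sub, Complex.norm_real, Real.norm_of_nonpos (by linarith)]
    ring
  have e2 := norm_exp_mul_I_sub_le t θ
  have e3 : |t - θ| ≤ Real.pi * ℓ := abs_le.2 ⟨by linarith [ht.1], by linarith [ht.2]⟩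
  have e4 := norm_sub_le_norm_sub_add_norm_sub ((r : ℂ) * Complex.exp (t * Complex.I))
    (Complex.exp (t * Complex.I)) (Complex.exp (θ * Complex.I))
  -- The radius contributes at most ℓ and the angle at most πℓ < 4ℓ.
  nlinarith [Real.pi_lt_four]

open Metric in
/-- The part of a large disc that lies near the unit circle is covered by few small discs. -/
theorem measure_ball_inter_le_of_cover {ν : Measure ℂ} {t : ℝ} (ht : 0 < t) {M : ℝ≥0∞}
    (hM : ∀ ζ : ℂ, ‖ζ‖ = 1 → ν (ball ζ (2 * t) ∩ unitDisc) ≤ M) {ζ : ℂ} (hζ : ‖ζ‖ = 1) {h : ℝ}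
    (hth : t ≤ h) :
    ν ((ball ζ h ∩ unitDisc) ∩ {z | 1 - ‖z‖ ≤ t}) ≤ ENNReal.ofReal (9 * (h / t)) * M := by
  obtain ⟨θ, rfl⟩ := (Complex.norm_eq_one_iff ζ).1 hζ
  -- Angles run up to πh and are rounded to multiples of t, which adds at most 1/2 to the index.
  set N : ℕ := ⌊Real.pi * (h / t) + 1 / 2⌋₊ with hN
  have hht : 1 ≤ h / t := by rwa [le_div_iff₀ ht, one_mul]
  have hcov : (ball (Complex.exp (θ * Complex.I)) h ∩ unitDisc) ∩ {z | 1 - ‖z‖ ≤ t} ⊆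
      ⋃ j ∈ Finset.Icc (-(N : ℤ)) N,
        (ball (Complex.exp ((θ + j * t : ℝ) * Complex.I)) (2 * t) ∩ unitDisc) := by
    rintro z ⟨⟨hz, hzD⟩, hzt⟩
    obtain ⟨φ, -, hφ, hzφ⟩ := exists_angle hzD θ
    rw [mem_ball, dist_eq_norm] at hz
    rw [mem_ofPred_eq] at hzt
    have hφh : |φ| ≤ Real.pi * h := hφ.trans (mul_le_mul_of_nonneg_left hz.le Real.pi_pos.le)
    have hr := abs_sub_round (φ / t)
    set j := round (φ / t) with hj
    have hjle : |(j : ℝ)| ≤ Real.pi * (h / t) + 1 / 2 := by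
      have h1 : |φ / t| ≤ Real.pi * (h / t) := by
        rw [abs_div, abs_of_pos ht, ← mul_div_assoc]
        gcongr
      have h2 := abs_sub_abs_le_abs_sub (j : ℝ) (φ / t)
      rw [abs_sub_comm] at hr
      linarith
    have hjN : |j| ≤ (N : ℤ) := by
      have h3 : (j.natAbs : ℝ) ≤ Real.pi * (h / t) + 1 / 2 := by
        rwa [Nat.cast_natAbs, Int.cast_abs]
      have h4 := Nat.le_floor h3
      rw [Int.abs_eq_natAbs]
      exact_mod_cast h4
    refine mem_biUnion (Finset.mem_coe.2 (Finset.mem_Icc.2 (abs_le.1 hjN))) ⟨?_, hzD⟩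
    rw [mem_ball, dist_eq_norm]
    -- The radial displacement is at most t and the rounding error at most t/2, together less than
    -- 2t.
    have e1 : ‖z - Complex.exp ((θ + φ : ℝ) * Complex.I)‖ ≤ t := by
      nth_rw 1 [hzφ]
      rw [← sub_one_mul, norm_mul, Complex.norm_exp_ofReal_mul_I, mul_one, ← Complex.ofReal_one,
        ← Complex.ofReal_sub, Complex.norm_real,
        Real.norm_of_nonpos (by linarith [mem_unitDisc.1 hzD])]
      linarith
    have e2 := norm_exp_mul_I_sub_le (θ + φ) (θ + j * t)
    have e3 : |θ + φ - (θ + j * t)| ≤ t / 2 := by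
      have : θ + φ - (θ + j * t) = t * (φ / t - j) := by field_simp; ring
      rw [this, abs_mul, abs_of_pos ht]
      nlinarith
    have e4 := norm_sub_le_norm_sub_add_norm_sub z (Complex.exp ((θ + φ : ℝ) * Complex.I))
      (Complex.exp ((θ + j * t : ℝ) * Complex.I))
    linarith
  -- 2N + 1 ≤ 2π(h/t) + 2, and h/t ≥ 1 absorbs the 2.
  have hcard : ((Finset.Icc (-(N : ℤ)) N).card : ℝ) ≤ 9 * (h / t) := by
    have h1 : (Finset.Icc (-(N : ℤ)) N).card = 2 * N + 1 := by
      rw [Int.card_Icc]; omega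
    have h2 : (N : ℝ) ≤ Real.pi * (h / t) + 1 / 2 := Nat.floor_le (by positivity)
    rw [h1]
    push_cast
    nlinarith [Real.pi_lt_d2]
  calc _ ≤ ν (⋃ j ∈ Finset.Icc (-(N : ℤ)) N,
        (ball (Complex.exp ((θ + j * t : ℝ) * Complex.I)) (2 * t) ∩ unitDisc)) := measure_mono hcov
    _ ≤ ∑ j ∈ Finset.Icc (-(N : ℤ)) N,
        ν (ball (Complex.exp ((θ + j * t : ℝ) * Complex.I)) (2 * t) ∩ unitDisc) :=
        measure_biUnion_finset_le _ _
    _ ≤ ∑ j ∈ Finset.Icc (-(N : ℤ)) N, M :=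
        Finset.sum_le_sum fun j _ => hM _ (Complex.norm_exp_ofReal_mul_I _)
    _ = ((Finset.Icc (-(N : ℤ)) N).card : ℝ≥0∞) * M := by rw [Finset.sum_const, nsmul_eq_mul]
    _ ≤ _ := by
        gcongr
        rw [← ENNReal.ofReal_natCast]
        exact ENNReal.ofReal_le_ofReal hcard

open Metric in
theorem IsBallCarleson.measure_unitDisc_lt_top {s : ℝ} {K : ℝ≥0} {ν : Measure ℂ}
    (h : IsBallCarleson s K ν) : ν unitDisc < ∞ := by
  have hsub : unitDisc ⊆ ball (1 : ℂ) 2 ∩ unitDisc := fun z hz => ⟨by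
    rw [mem_ball]
    have := dist_triangle z 0 1
    rw [dist_zero_right, dist_zero_left, norm_one] at this
    linarith [mem_unitDisc.1 hz], hz⟩
  exact ((measure_mono hsub).trans (h 1 norm_one 2 two_pos)).trans_lt
    (ENNReal.mul_lt_top ENNReal.coe_lt_top ENNReal.ofReal_lt_top)

-- The layer 1 - |z| ≤ t of a disc of radius h is covered by O(h/t) discs of radius 2t, so its mass
-- is O(h t^(s-1)). Summing over t = 2^(-k) h converges because b < s - 1.
open Metric in
theorem exists_lintegral_boundary_dist_rpow_neg_le {s b : ℝ} (hb : b < s - 1) :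
    ∃ C : ℝ≥0, ∀ (ν : Measure ℂ) (K : ℝ≥0), IsBallCarleson s K ν → ∀ ζ : ℂ, ‖ζ‖ = 1 →
      ∀ h : ℝ, 0 < h → ∫⁻ z in ball ζ h ∩ unitDisc, ENNReal.ofReal ((1 - ‖z‖) ^ (-b)) ∂ν ≤
        C * K * ENNReal.ofReal (h ^ (s - b)) := by
  obtain ⟨C, hC⟩ := exists_lintegral_rpow_neg_le (ρ := 1 / 2) (a := s - 1) (b := b) (by norm_num)
    (Real.rpow_lt_one (by norm_num) (by norm_num) (by linarith))
  refine ⟨C * Real.toNNReal (9 * 2 ^ s), fun ν K hν ζ hζ h hh => ?_⟩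
  have hk1 : ∀ k : ℕ, (1 / 2 : ℝ) ^ k ≤ 1 := fun k => pow_le_one₀ (by norm_num) (by norm_num)
  refine (hC ν (ball ζ h ∩ unitDisc) (fun z => 1 - ‖z‖) h
    (K * ENNReal.ofReal (9 * 2 ^ s * h)) hh
    (measurableSet_ball.inter isOpen_unitDisc.measurableSet) (by fun_prop) ?_ ?_).trans ?_
  · rintro z ⟨hz, hzD⟩
    have h1 : 0 < 1 - ‖z‖ := by linarith [mem_unitDisc.1 hzD]
    have h2 : 1 - ‖z‖ ≤ h := by
      have := norm_sub_norm_le ζ z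
      rw [hζ, norm_sub_rev, ← dist_eq_norm] at this
      linarith [mem_ball.1 hz]
    obtain ⟨n, hn1, hn2⟩ := exists_nat_pow_near_of_lt_one (div_pos h1 hh)
      ((div_le_one hh).2 h2) (by norm_num : (0 : ℝ) < 1 / 2) (by norm_num)
    rw [lt_div_iff₀ hh] at hn1
    rw [div_le_iff₀ hh] at hn2
    refine ⟨n, ?_, hn2⟩
    rw [pow_succ] at hn1
    linarith
  · intro k
    have ht : 0 < (1 / 2 : ℝ) ^ k * h := by positivity
    set t := (1 / 2 : ℝ) ^ k * h with htdef
    have hth : t ≤ h := mul_le_of_le_one_left hh.le (hk1 k)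
    refine (measure_ball_inter_le_of_cover ht (M := K * ENNReal.ofReal ((2 * t) ^ s))
      (fun ζ hζ => hν ζ hζ _ (by positivity)) hζ hth).trans_eq ?_
    rw [mul_left_comm, ← ENNReal.ofReal_mul (by positivity), mul_assoc (K : ℝ≥0∞),
      ← ENNReal.ofReal_mul (by positivity)]
    congr 2
    rw [Real.mul_rpow (by norm_num) ht.le, Real.rpow_sub_one ht.ne']
    ring
  · refine le_of_eq ?_
    rw [show s - 1 - b = s - b - 1 by ring, mul_assoc, mul_assoc, ← ENNReal.ofReal_mul (by positivity),
      Real.rpow_sub_one hh.ne', ENNReal.coe_mul, ENNReal.ofNNReal_toNNReal,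
      show 9 * 2 ^ s * h * (h ^ (s - b) / h) = 9 * 2 ^ s * h ^ (s - b) by field_simp,
      ENNReal.ofReal_mul (by positivity)]
    ring

open Metric in
theorem isBallCarleson_areaMeasure : IsBallCarleson 2 1 areaMeasure := by
  intro ζ _ h hh
  refine (measure_mono inter_subset_left).trans_eq ?_
  have hpi : ENNReal.ofReal Real.pi ≠ 0 := by simp [Real.pi_pos]
  rw [areaMeasure, Measure.smul_apply, Complex.volume_ball, smul_eq_mul, ENNReal.coe_one, one_mul,
    Real.rpow_two, ENNReal.ofReal_pow hh.le, mul_left_comm, ← ENNReal.ofReal_coe_nnreal,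
    NNReal.coe_real_pi, ENNReal.inv_mul_cancel hpi ENNReal.ofReal_ne_top, mul_one]

open Metric in
/-- The weighted area measure `(1 - |z|)^α dA` is Carleson of order `α + 2`. -/
theorem exists_isBallCarleson_weighted {α : ℝ} (hα : -1 < α) :
    ∃ C : ℝ≥0, IsBallCarleson (α + 2) C ((areaMeasure.restrict unitDisc).withDensity
      fun z => ENNReal.ofReal ((1 - ‖z‖) ^ α)) := by
  obtain ⟨C, hC⟩ := exists_lintegral_boundary_dist_rpow_neg_le (s := 2) (b := -α) (by linarith)
  refine ⟨C, fun ζ hζ h hh => ?_⟩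
  have hm : MeasurableSet (ball ζ h ∩ unitDisc) :=
    measurableSet_ball.inter isOpen_unitDisc.measurableSet
  rw [withDensity_apply _ hm, Measure.restrict_restrict hm, inter_assoc, inter_self]
  have := hC _ _ isBallCarleson_areaMeasure ζ hζ h hh
  simpa [add_comm] using this

open Metric in
theorem IsCarlesonMeasure.exists_isBallCarleson {s : ℝ} (hs : 0 ≤ s) {μ : Measure ℂ}
    (h : IsCarlesonMeasure s μ) : ∃ K : ℝ≥0, IsBallCarleson s K μ := by
  have hle : ∀ θ : ℝ, ∀ ℓ ∈ Ioc (0 : ℝ) 1, μ (carlesonSquare θ ℓ) ≤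
      carlesonNorm s μ * ENNReal.ofReal (ℓ ^ s) := by
    intro θ ℓ hℓ
    have h1 : μ (carlesonSquare θ ℓ) / ENNReal.ofReal (ℓ ^ s) ≤ carlesonNorm s μ :=
      le_iSup_of_le θ (le_iSup_of_le ℓ (le_iSup_of_le hℓ le_rfl))
    have h2 := Real.rpow_pos_of_pos hℓ.1 s
    rwa [ENNReal.div_le_iff (by simpa using h2) ENNReal.ofReal_ne_top] at h1
  refine ⟨(carlesonNorm s μ).toNNReal, fun ζ hζ r hr => ?_⟩
  rw [ENNReal.coe_toNNReal h.ne]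
  obtain ⟨θ, rfl⟩ := (Complex.norm_eq_one_iff ζ).1 hζ
  rcases le_total r 1 with h1 | h1
  · exact (measure_mono (ball_inter_unitDisc_subset_carlesonSquare θ)).trans (hle θ r ⟨hr, h1⟩)
  -- A disc of radius at least 1 is handled by the square over the full circle, which is all of the
  -- unit disc.
  · have h2 := hle θ 1 (by norm_num)
    rw [carlesonSquare_one] at h2
    refine ((measure_mono inter_subset_right).trans h2).trans ?_
    gcongr

/-- A vanishing Carleson measure has small Carleson constant near the unit circle. -/
theorem IsVanishingCarlesonMeasure.exists_isBallCarleson_restrict {s : ℝ} (hs : 1 ≤ s)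
    {μ : Measure ℂ} (h : IsVanishingCarlesonMeasure s μ) {ε : ℝ≥0} (hε : 0 < ε) :
    ∃ r : ℝ, 0 < r ∧ r < 1 ∧ IsBallCarleson s ε (μ.restrict {z | r < ‖z‖}) := by
  -- The loss incurred below when a large disc is covered by discs of radius 2u.
  set c : ℝ≥0 := Real.toNNReal (9 * 2 ^ s) with hc
  have hc9 : (1 : ℝ) ≤ 9 * 2 ^ s := by
    have : (1 : ℝ) ≤ 2 ^ s := Real.one_le_rpow (by norm_num) (by linarith)
    linarith
  have hc1 : 1 ≤ c := by
    rw [hc, Real.one_le_toNNReal]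
    exact hc9
  have hη : (0 : ℝ≥0∞) < ((ε / c : ℝ≥0) : ℝ≥0∞) := by
    have : 0 < ε / c := div_pos hε (by positivity)
    exact_mod_cast this
  have hev := h.2.eventually_lt_const hη
  rw [eventually_iff, mem_nhdsGT_iff_exists_Ioo_subset] at hev
  obtain ⟨δ, hδ, hev⟩ := hev
  rw [mem_Ioi] at hδ
  set u := min δ 1 / 4 with hu
  have hu0 : 0 < u := by positivity
  have hu1 : 4 * u ≤ 1 := by rw [hu]; linarith [min_le_right δ 1]
  have huδ : 4 * u ≤ δ := by rw [hu]; linarith [min_le_left δ 1]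
  have hsmall : ∀ ζ : ℂ, ‖ζ‖ = 1 → ∀ r, 0 < r → r ≤ 2 * u →
      μ (Metric.ball ζ r ∩ unitDisc) ≤ (ε / c : ℝ≥0) * ENNReal.ofReal (r ^ s) := by
    intro ζ hζ r hr hru
    obtain ⟨θ, rfl⟩ := (Complex.norm_eq_one_iff ζ).1 hζ
    refine (measure_mono (ball_inter_unitDisc_subset_carlesonSquare θ)).trans ?_
    have h1 := hev (show r ∈ Ioo 0 δ from ⟨hr, by linarith⟩)
    have h2 := (le_iSup (fun θ => μ (carlesonSquare θ r) / ENNReal.ofReal (r ^ s)) θ).trans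
      (le_of_lt h1)
    have h3 := Real.rpow_pos_of_pos hr s
    rwa [ENNReal.div_le_iff (by simpa using h3) ENNReal.ofReal_ne_top] at h2
  refine ⟨1 - u, by linarith, by linarith, fun ζ hζ r hr => ?_⟩
  have hm : MeasurableSet {z : ℂ | 1 - u < ‖z‖} := measurableSet_lt measurable_const measurable_norm
  rcases le_total r (2 * u) with hru | hru
  · refine ((Measure.restrict_apply_le _ _).trans (hsmall ζ hζ r hr hru)).trans ?_
    gcongr
    exact div_le_self zero_le hc1
  -- For large radii only the annulus 1 - |z| ≤ u carries mass. The covering gives O(r u^(s-1)),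
  -- which is O(r^s) because s ≥ 1.
  · rw [Measure.restrict_apply' hm]
    have hsub : Metric.ball ζ r ∩ unitDisc ∩ {z : ℂ | 1 - u < ‖z‖} ⊆
        Metric.ball ζ r ∩ unitDisc ∩ {z : ℂ | 1 - ‖z‖ ≤ u} :=
      inter_subset_inter_right _ fun z (hz : 1 - u < ‖z‖) => show 1 - ‖z‖ ≤ u by linarith
    refine ((measure_mono hsub).trans (measure_ball_inter_le_of_cover hu0
      (fun ζ hζ => hsmall ζ hζ (2 * u) (by positivity) le_rfl) hζ (by linarith : u ≤ r))).trans ?_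
    rw [mul_left_comm, ← ENNReal.ofReal_mul (by positivity)]
    have h4 : 9 * (r / u) * (2 * u) ^ s ≤ 9 * 2 ^ s * r ^ s := by
      have h5 : u ^ (s - 1) ≤ r ^ (s - 1) := by
        apply Real.rpow_le_rpow hu0.le <;> linarith
      rw [Real.mul_rpow (by norm_num) hu0.le]
      rw [Real.rpow_sub_one hu0.ne', Real.rpow_sub_one hr.ne', div_le_div_iff₀ hu0 hr] at h5
      calc 9 * (r / u) * (2 ^ s * u ^ s) = 9 * 2 ^ s * ((u ^ s * r) / u) := by ring
        _ ≤ 9 * 2 ^ s * (r ^ s) := by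
          gcongr
          rwa [div_le_iff₀ hu0]
    calc _ ≤ ((ε / c : ℝ≥0) : ℝ≥0∞) * ENNReal.ofReal (9 * 2 ^ s * r ^ s) := by gcongr
      _ = ((ε / c * c : ℝ≥0) : ℝ≥0∞) * ENNReal.ofReal (r ^ s) := by
          rw [ENNReal.ofReal_mul (by positivity), ← mul_assoc, ENNReal.coe_mul]
          rfl
      _ = _ := by rw [div_mul_cancel₀ _ (by positivity)]

/-! ### Weighted local estimates and pointwise growth -/

theorem enorm_rpow_eq_ofReal {p : ℝ} (hp : 0 ≤ p) (x : ℂ) : ‖x‖ₑ ^ p = ENNReal.ofReal (‖x‖ ^ p) := by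
  rw [← ofReal_norm, ENNReal.ofReal_rpow_of_nonneg (norm_nonneg _) hp]

/-- Bounding the sum by twice the larger term treats p ≤ 1 and p ≥ 1 at once. -/
theorem add_rpow_le_two_rpow_mul {p : ℝ} (hp : 0 ≤ p) (x y : ℝ≥0∞) :
    (x + y) ^ p ≤ 2 ^ p * (x ^ p + y ^ p) := by
  wlog h : x ≤ y
  · rw [add_comm x, add_comm (x ^ p)]
    exact this hp y x (le_of_not_ge h)
  calc (x + y) ^ p ≤ (2 * y) ^ p := by
        gcongr
        rw [two_mul]
        gcongr
    _ = 2 ^ p * y ^ p := ENNReal.mul_rpow_of_nonneg _ _ hp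
    _ ≤ _ := by
        gcongr
        exact le_add_self

open Metric in
/-- Weighted local sub-mean value inequality on the unit disc. -/
theorem exists_enorm_rpow_mul_le_lintegral_ball {p : ℝ} (hp : 0 < p) (γ : ℝ) :
    ∃ C : ℝ≥0, ∀ g : ℂ → ℂ, DifferentiableOn ℂ g unitDisc → ∀ w ∈ unitDisc,
      ‖g w‖ₑ ^ p * ENNReal.ofReal ((1 - ‖w‖) ^ (2 + γ)) ≤
        C * ∫⁻ u in ball w ((1 - ‖w‖) / 2),
          ‖g u‖ₑ ^ p * ENNReal.ofReal ((1 - ‖u‖) ^ γ) ∂areaMeasure := by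
  obtain ⟨C, hC⟩ := exists_enorm_rpow_center_le hp
  refine ⟨4 * C * Real.toNNReal (2 ^ |γ|), fun g hg w hw => ?_⟩
  have hd : 0 < 1 - ‖w‖ := by linarith [mem_unitDisc.1 hw]
  set d := 1 - ‖w‖ with hdd
  have hsub : ball w (d / 2) ⊆ unitDisc := ball_subset_unitDisc (by linarith)
  have h1 := hC g w (d / 2) (by positivity) (hg.mono hsub)
  have h2 : ENNReal.ofReal (d ^ γ) * ∫⁻ z in ball w (d / 2), ‖g z‖ₑ ^ p ∂areaMeasure ≤
      ENNReal.ofReal (2 ^ |γ|) * ∫⁻ u in ball w (d / 2),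
          ‖g u‖ₑ ^ p * ENNReal.ofReal ((1 - ‖u‖) ^ γ) ∂areaMeasure := by
    rw [← lintegral_const_mul' _ _ ENNReal.ofReal_ne_top,
      ← lintegral_const_mul' _ _ ENNReal.ofReal_ne_top]
    refine setLIntegral_mono' measurableSet_ball fun u hu => ?_
    -- On this disc 1 - |u| lies between d/2 and 3d/2, so the weight is constant up to the factor
    -- 2^|γ|.
    have h3 : |‖u‖ - ‖w‖| < d / 2 := by
      refine (abs_norm_sub_norm_le u w).trans_lt ?_
      rw [← dist_eq_norm]
      exact hu
    have h4 : d ^ γ ≤ 2 ^ |γ| * (1 - ‖u‖) ^ γ := by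
      have := abs_lt.1 h3
      exact rpow_le_of_comparable γ hd two_pos (by linarith) (by linarith)
    calc ENNReal.ofReal (d ^ γ) * ‖g u‖ₑ ^ p
        ≤ ENNReal.ofReal (2 ^ |γ| * (1 - ‖u‖) ^ γ) * ‖g u‖ₑ ^ p := by gcongr
      _ = _ := by
          rw [ENNReal.ofReal_mul (by positivity)]
          ring
  have h5 : d ^ (2 + γ) = 4 * ((d / 2) ^ 2 * d ^ γ) := by
    rw [Real.rpow_add hd, Real.rpow_two]
    ring
  calc ‖g w‖ₑ ^ p * ENNReal.ofReal (d ^ (2 + γ))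
      = 4 * (ENNReal.ofReal (d ^ γ) * (‖g w‖ₑ ^ p * ENNReal.ofReal ((d / 2) ^ 2))) := by
        rw [h5, ENNReal.ofReal_mul (by norm_num), ENNReal.ofReal_mul (by positivity),
          ENNReal.ofReal_ofNat]
        ring
    _ ≤ 4 * (ENNReal.ofReal (d ^ γ) *
          (C * ∫⁻ z in ball w (d / 2), ‖g z‖ₑ ^ p ∂areaMeasure)) := by gcongr
    _ = 4 * C * (ENNReal.ofReal (d ^ γ) * ∫⁻ z in ball w (d / 2), ‖g z‖ₑ ^ p ∂areaMeasure) := by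
        ring
    _ ≤ 4 * C * (ENNReal.ofReal (2 ^ |γ|) * ∫⁻ u in ball w (d / 2),
          ‖g u‖ₑ ^ p * ENNReal.ofReal ((1 - ‖u‖) ^ γ) ∂areaMeasure) := by gcongr
    _ = _ := by
        push_cast
        rw [ENNReal.ofNNReal_toNNReal]
        ring

/-- Radial growth of an analytic function in terms of a weighted bound for `|f'|^p`. -/
theorem enorm_radial_sub_rpow_le {p : ℝ} (hp : 0 < p) {f : ℂ → ℂ}
    (hf : DifferentiableOn ℂ f unitDisc) {ζ : ℂ} (hζ : ‖ζ‖ = 1) {a b ε : ℝ} (ha : 0 ≤ a)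
    (hab : a ≤ b) (hb : b < 1) (hε : 0 < ε) {N : ℝ≥0∞}
    (h : ∀ t ∈ Icc a b, ‖deriv f (t * ζ)‖ₑ ^ p * ENNReal.ofReal ((1 - t) ^ (p + p * ε)) ≤ N) :
    ‖f (b * ζ) - f (a * ζ)‖ₑ ^ p ≤
      ENNReal.ofReal (ε ^ (-p)) * N * ENNReal.ofReal ((1 - b) ^ (-(p * ε))) := by
  have hb0 : 0 < 1 - b := by linarith
  rcases eq_or_ne N ∞ with rfl | hN
  · have h1 : 0 < ε ^ (-p) := by positivity
    have h2 : 0 < (1 - b) ^ (-(p * ε)) := by positivity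
    rw [ENNReal.mul_top (by simpa using h1), ENNReal.top_mul (by simpa using h2)]
    exact le_top
  set M := N.toReal ^ (1 / p) with hM
  have hM0 : 0 ≤ M := by positivity
  have hMp : M ^ p = N.toReal := by
    rw [hM, ← Real.rpow_mul ENNReal.toReal_nonneg, one_div_mul_cancel hp.ne', Real.rpow_one]
  have hder : ∀ t ∈ Icc a b, ‖deriv f (t * ζ)‖ ≤ M * (1 - t) ^ (-1 - ε) := by
    intro t ht
    have ht0 : 0 < 1 - t := by linarith [ht.2]
    have h1 := h t ht
    rw [enorm_rpow_eq_ofReal hp.le, ← ENNReal.ofReal_mul (by positivity),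
      ENNReal.ofReal_le_iff_le_toReal hN, ← hMp] at h1
    refine (Real.rpow_le_rpow_iff (norm_nonneg _) (by positivity) hp).1 ?_
    rw [Real.mul_rpow hM0 (by positivity), ← Real.rpow_mul ht0.le,
      show (-1 - ε) * p = -(p + p * ε) by ring, Real.rpow_neg ht0.le, ← div_eq_mul_inv,
      le_div_iff₀ (by positivity)]
    exact h1
  have h1 := norm_radial_sub_le hf hζ ha hab hb hε hM0 hder
  rw [enorm_rpow_eq_ofReal hp.le]
  refine (ENNReal.ofReal_le_ofReal (Real.rpow_le_rpow (norm_nonneg _) h1 hp.le)).trans_eq ?_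
  rw [Real.mul_rpow (by positivity) (by positivity), Real.div_rpow hM0 hε.le, hMp,
    ← Real.rpow_mul hb0.le, show -ε * p = -(p * ε) by ring, div_eq_mul_inv, ← Real.rpow_neg hε.le,
    ENNReal.ofReal_mul (by positivity), ENNReal.ofReal_mul (by positivity), ENNReal.ofReal_toReal hN,
    mul_comm N]

theorem exists_unit_mul_norm (u : ℂ) : ∃ ζ : ℂ, ‖ζ‖ = 1 ∧ u = ‖u‖ * ζ :=
  ⟨_, Complex.norm_exp_ofReal_mul_I u.arg, (Complex.norm_mul_exp_arg_mul_I u).symm⟩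

/-- The integral of `|f|^p (1 - |z|)^α` over the unit disc. -/
noncomputable def weightedIntegral (p α : ℝ) (f : ℂ → ℂ) : ℝ≥0∞ :=
  ∫⁻ z in unitDisc, ‖f z‖ₑ ^ p * ENNReal.ofReal ((1 - ‖z‖) ^ α) ∂areaMeasure

theorem exists_enorm_rpow_le_weightedIntegral {p : ℝ} (hp : 0 < p) (α : ℝ) :
    ∃ C : ℝ≥0, ∀ g : ℂ → ℂ, DifferentiableOn ℂ g unitDisc → ∀ w ∈ unitDisc,
      ‖g w‖ₑ ^ p * ENNReal.ofReal ((1 - ‖w‖) ^ (2 + α)) ≤ C * weightedIntegral p α g := by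
  obtain ⟨C, hC⟩ := exists_enorm_rpow_mul_le_lintegral_ball hp α
  refine ⟨C, fun g hg w hw => (hC g hg w hw).trans ?_⟩
  gcongr
  exact lintegral_mono_set (ball_subset_unitDisc (by linarith [mem_unitDisc.1 hw]))

/-- Pointwise growth of functions in the Dirichlet type space. -/
theorem exists_enorm_rpow_le_of_deriv {p : ℝ} (hp : 0 < p) :
    ∃ C : ℝ≥0, ∀ f : ℂ → ℂ, DifferentiableOn ℂ f unitDisc → ∀ z ∈ unitDisc,
      ‖f z‖ₑ ^ p * ENNReal.ofReal (1 - ‖z‖) ≤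
        C * (‖f 0‖ₑ ^ p + weightedIntegral p (p - 1) (deriv f)) := by
  obtain ⟨C, hC⟩ := exists_enorm_rpow_le_weightedIntegral hp (p - 1)
  have h2p : (2 : ℝ≥0∞) ^ p ≠ ∞ := ENNReal.rpow_ne_top_of_nonneg hp.le (by simp)
  set A : ℝ≥0∞ := ENNReal.ofReal ((1 / p) ^ (-p)) * C with hA
  have hAt : A ≠ ∞ := ENNReal.mul_ne_top ENNReal.ofReal_ne_top ENNReal.coe_ne_top
  refine ⟨(2 ^ p * (A + 1)).toNNReal, fun f hf z hz => ?_⟩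
  rw [ENNReal.coe_toNNReal (ENNReal.mul_ne_top h2p (ENNReal.add_ne_top.2 ⟨hAt, by simp⟩))]
  set J := weightedIntegral p (p - 1) (deriv f) with hJ
  have hz1 := mem_unitDisc.1 hz
  have hz0 : 0 < 1 - ‖z‖ := by linarith
  obtain ⟨ζ, hζ, hzζ⟩ := exists_unit_mul_norm z
  -- The choice ε = 1/p makes p + pε = 2 + (p - 1), the exponent of the pointwise bound for f'.
  have h1 := enorm_radial_sub_rpow_le hp hf hζ le_rfl (norm_nonneg z) hz1
    (by positivity : 0 < 1 / p) (N := C * J) fun t ht => by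
      have ht1 : ‖(t : ℂ) * ζ‖ = t := by
        rw [norm_mul, hζ, mul_one, Complex.norm_real, Real.norm_of_nonneg ht.1]
      have h2 := hC (deriv f) (hf.deriv isOpen_unitDisc) (t * ζ)
        (mem_unitDisc.2 (by rw [ht1]; linarith [ht.2]))
      rw [ht1] at h2
      convert h2 using 4
      field_simp
      ring
  rw [← hzζ, Complex.ofReal_zero, zero_mul, mul_one_div_cancel hp.ne', ← mul_assoc, ← hA,
    Real.rpow_neg_one] at h1
  have h3 : ENNReal.ofReal (1 - ‖z‖)⁻¹ * ENNReal.ofReal (1 - ‖z‖) = 1 := by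
    rw [← ENNReal.ofReal_mul (by positivity), inv_mul_cancel₀ hz0.ne', ENNReal.ofReal_one]
  have h4 : ENNReal.ofReal (1 - ‖z‖) ≤ 1 := by
    rw [← ENNReal.ofReal_one]
    exact ENNReal.ofReal_le_ofReal (by linarith [norm_nonneg z])
  calc ‖f z‖ₑ ^ p * ENNReal.ofReal (1 - ‖z‖)
      ≤ (‖f z - f 0‖ₑ + ‖f 0‖ₑ) ^ p * ENNReal.ofReal (1 - ‖z‖) := by
        gcongr
        simpa using enorm_add_le (f z - f 0) (f 0)
    _ ≤ 2 ^ p * (‖f z - f 0‖ₑ ^ p + ‖f 0‖ₑ ^ p) * ENNReal.ofReal (1 - ‖z‖) := by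
        gcongr
        exact add_rpow_le_two_rpow_mul hp.le _ _
    _ ≤ 2 ^ p * (A * J * ENNReal.ofReal (1 - ‖z‖)⁻¹ + ‖f 0‖ₑ ^ p) * ENNReal.ofReal (1 - ‖z‖) := by
        gcongr
    _ = 2 ^ p * (A * J * (ENNReal.ofReal (1 - ‖z‖)⁻¹ * ENNReal.ofReal (1 - ‖z‖)) +
          ‖f 0‖ₑ ^ p * ENNReal.ofReal (1 - ‖z‖)) := by ring
    _ ≤ 2 ^ p * (A * J * 1 + ‖f 0‖ₑ ^ p * 1) := by
        rw [h3]
        gcongr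
    _ ≤ 2 ^ p * ((A + 1) * J + (A + 1) * ‖f 0‖ₑ ^ p) := by
        rw [mul_one, mul_one]
        exact mul_le_mul_right (add_le_add (mul_le_mul_left le_self_add _)
          (le_mul_of_one_le_left' le_add_self)) _
    _ = _ := by ring

/-! ### Schur estimate and the two Carleson embeddings -/

instance : SFinite areaMeasure := by
  unfold areaMeasure
  infer_instance

/-- Values off the disc are arbitrary; extension by zero supplies the global measurability that
Tonelli needs. -/
theorem measurable_indicator_unitDisc {g : ℂ → ℂ} (hg : ContinuousOn g unitDisc) :
    Measurable (unitDisc.indicator g) := by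
  classical
  rw [← piecewise_eq_indicator]
  exact hg.measurable_piecewise continuousOn_const isOpen_unitDisc.measurableSet

/-- A Schur type estimate: a function that is dominated by a positive kernel operator is integrable
against `ν` as soon as the transposed kernel is. -/
theorem setLIntegral_le_of_kernel {ν : Measure ℂ} (hν : ν unitDisc < ∞) {E : Set ℂ}
    (hE : E ⊆ unitDisc) {F G H B : ℂ → ℝ≥0∞} (c : ℝ≥0∞) {R : Set (ℂ × ℂ)} (hR : MeasurableSet R)
    (hG : Measurable G) (hH : Measurable H)
    (hF : ∀ z ∈ E,
      F z ≤ H z * ∫⁻ u in unitDisc, R.indicator (fun w => G w.2) (z, u) ∂areaMeasure + c)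
    (hB : ∀ u ∈ unitDisc, ∫⁻ z in {z | (z, u) ∈ R} ∩ unitDisc, H z ∂ν ≤ B u) :
    ∫⁻ z in E, F z ∂ν ≤ ∫⁻ u in unitDisc, G u * B u ∂areaMeasure + c * ν E := by
  -- Finiteness makes the restricted measure s-finite, as the exchange of integrals requires.
  have : IsFiniteMeasure (ν.restrict unitDisc) := ⟨by simpa using hν⟩
  have hk : Measurable (R.indicator fun w : ℂ × ℂ => G w.2) :=
    (hG.comp measurable_snd).indicator hR
  have hk' : Measurable fun z => H z *
      ∫⁻ u in unitDisc, R.indicator (fun w => G w.2) (z, u) ∂areaMeasure :=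
    hH.mul hk.lintegral_prod_right'
  refine (setLIntegral_mono (hk'.add_const c) hF).trans ?_
  rw [lintegral_add_right _ measurable_const, lintegral_const, Measure.restrict_apply_univ]
  refine add_le_add ?_ le_rfl
  calc ∫⁻ z in E, H z *
          ∫⁻ u in unitDisc, R.indicator (fun w => G w.2) (z, u) ∂areaMeasure ∂ν
      ≤ ∫⁻ z in unitDisc, H z *
          ∫⁻ u in unitDisc, R.indicator (fun w => G w.2) (z, u) ∂areaMeasure ∂ν :=
        lintegral_mono_set hE
    _ = ∫⁻ z in unitDisc, ∫⁻ u in unitDisc,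
          H z * R.indicator (fun w => G w.2) (z, u) ∂areaMeasure ∂ν := by
        refine lintegral_congr fun z => (lintegral_const_mul _ ?_).symm
        exact hk.comp measurable_prodMk_left
    _ = ∫⁻ u in unitDisc, ∫⁻ z in unitDisc,
          H z * R.indicator (fun w => G w.2) (z, u) ∂ν ∂areaMeasure :=
        lintegral_lintegral_swap ((hH.comp measurable_fst).mul hk).aemeasurable
    _ ≤ _ := by
        refine setLIntegral_mono' isOpen_unitDisc.measurableSet fun u hu => ?_
        have hm : MeasurableSet {z | (z, u) ∈ R} := measurable_prodMk_right hR
        calc ∫⁻ z in unitDisc, H z * R.indicator (fun w => G w.2) (z, u) ∂ν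
            = ∫⁻ z in unitDisc, G u * {z | (z, u) ∈ R}.indicator H z ∂ν := by
              refine lintegral_congr fun z => ?_
              by_cases h : (z, u) ∈ R
              · rw [indicator_of_mem h, indicator_of_mem (show z ∈ {z | (z, u) ∈ R} from h),
                  mul_comm]
              · rw [indicator_of_notMem h,
                  indicator_of_notMem (show z ∉ {z | (z, u) ∈ R} from h), mul_zero, mul_zero]
          _ = G u * ∫⁻ z in {z | (z, u) ∈ R} ∩ unitDisc, H z ∂ν := by
              rw [lintegral_const_mul _ (hH.indicator hm), lintegral_indicator hm,
                Measure.restrict_restrict hm]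
          _ ≤ _ := by
              gcongr
              exact hB u hu

/-- Since |u - ζ| = 1 - |u|, the support of the transposed kernel at u falls in a boundary disc,
where the Carleson condition applies. -/
theorem mem_ball_of_dist_le {z u ζ : ℂ} (hζ : ‖ζ‖ = 1) (hu : u = ‖u‖ * ζ) (hu1 : ‖u‖ < 1) {c : ℝ}
    (h : ‖u - z‖ < c * (1 - ‖u‖)) : z ∈ Metric.ball ζ ((c + 1) * (1 - ‖u‖)) := by
  have h1 : ‖u - ζ‖ = 1 - ‖u‖ := by
    nth_rw 1 [hu]
    rw [← sub_one_mul, norm_mul, hζ, mul_one, ← Complex.ofReal_one, ← Complex.ofReal_sub,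
      Complex.norm_real, Real.norm_of_nonpos (by linarith)]
    ring
  rw [Metric.mem_ball, dist_eq_norm]
  have h2 := norm_sub_le_norm_sub_add_norm_sub z u ζ
  rw [norm_sub_rev z u] at h2
  linarith

theorem measurable_indicator_mul_weight {p : ℝ} {g : ℂ → ℂ} (hg : DifferentiableOn ℂ g unitDisc)
    (γ : ℝ) :
    Measurable fun u => ‖unitDisc.indicator g u‖ₑ ^ p * ENNReal.ofReal ((1 - ‖u‖) ^ γ) := by
  have := measurable_indicator_unitDisc hg.continuousOn
  fun_prop

/-- The Carleson embedding of the weighted Bergman space. -/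
theorem exists_lintegral_le_of_isBallCarleson {p q : ℝ} (hp : 0 < p) (hq : 0 < q) :
    ∃ C : ℝ≥0, ∀ (ν : Measure ℂ) (K : ℝ≥0) (f : ℂ → ℂ), IsBallCarleson (q + 1) K ν →
      DifferentiableOn ℂ f unitDisc →
      ∫⁻ z in unitDisc, ‖f z‖ₑ ^ p ∂ν ≤ C * K * weightedIntegral p (q - 1) f := by
  obtain ⟨C, hC⟩ := exists_enorm_rpow_mul_le_lintegral_ball hp (q - 1)
  refine ⟨C * Real.toNNReal (2 ^ (q + 1) * 2 ^ (q + 1)), fun ν K f hν hf => ?_⟩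
  have hgm := measurable_indicator_mul_weight (p := p) hf (q - 1)
  -- For fixed u, the relevant z satisfy 1 - |z| ≈ 1 - |u| = d and lie in a boundary disc of radius
  -- 2d. The weight d^(-(q+1)) cancels its mass K d^(q+1) up to a constant, so `B` is constant.
  refine (setLIntegral_le_of_kernel hν.measure_unitDisc_lt_top subset_rfl 0
    (R := {w | ‖w.2 - w.1‖ < (1 - ‖w.1‖) / 2})
    (H := fun z => C * ENNReal.ofReal ((1 - ‖z‖) ^ (-(q + 1))))
    (B := fun _ => C * (ENNReal.ofReal (2 ^ (q + 1) * 2 ^ (q + 1)) * K))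
    (measurableSet_lt (by fun_prop) (by fun_prop)) hgm (by fun_prop) ?_ ?_).trans_eq ?_
  · intro z hz
    have hz0 : 0 < 1 - ‖z‖ := by linarith [mem_unitDisc.1 hz]
    have hsub : Metric.ball z ((1 - ‖z‖) / 2) ⊆ unitDisc := ball_subset_unitDisc (by linarith)
    have h1 := hC f hf z hz
    have h2 : ∫⁻ u in Metric.ball z ((1 - ‖z‖) / 2),
          ‖f u‖ₑ ^ p * ENNReal.ofReal ((1 - ‖u‖) ^ (q - 1)) ∂areaMeasure =
        ∫⁻ u in unitDisc, {w : ℂ × ℂ | ‖w.2 - w.1‖ < (1 - ‖w.1‖) / 2}.indicator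
          (fun w => ‖unitDisc.indicator f w.2‖ₑ ^ p * ENNReal.ofReal ((1 - ‖w.2‖) ^ (q - 1)))
          (z, u) ∂areaMeasure := by
      rw [← inter_eq_left.2 hsub, ← Measure.restrict_restrict measurableSet_ball,
        ← lintegral_indicator measurableSet_ball]
      refine setLIntegral_congr_fun isOpen_unitDisc.measurableSet fun u hu => ?_
      by_cases h : ‖u - z‖ < (1 - ‖z‖) / 2
      · rw [indicator_of_mem (by rwa [Metric.mem_ball, dist_eq_norm]), indicator_of_mem (by exact h),
          indicator_of_mem hu]
      · rw [indicator_of_notMem (by rwa [Metric.mem_ball, dist_eq_norm]),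
          indicator_of_notMem (by exact h)]
    rw [← h2, add_zero]
    calc ‖f z‖ₑ ^ p = ENNReal.ofReal ((1 - ‖z‖) ^ (-(q + 1))) *
          (‖f z‖ₑ ^ p * ENNReal.ofReal ((1 - ‖z‖) ^ (2 + (q - 1)))) := by
          rw [mul_left_comm, ← ENNReal.ofReal_mul (by positivity), ← Real.rpow_add hz0,
            show -(q + 1) + (2 + (q - 1)) = 0 by ring, Real.rpow_zero, ENNReal.ofReal_one, mul_one]
      _ ≤ ENNReal.ofReal ((1 - ‖z‖) ^ (-(q + 1))) * _ := mul_le_mul_right h1 _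
      _ = _ := by ring
  · intro u hu
    have hu1 := mem_unitDisc.1 hu
    set d := 1 - ‖u‖ with hd
    have hd0 : 0 < d := by linarith
    obtain ⟨ζ, hζ, huζ⟩ := exists_unit_mul_norm u
    rw [lintegral_const_mul' _ _ ENNReal.coe_ne_top]
    gcongr
    have hsub : {z | (z, u) ∈ {w : ℂ × ℂ | ‖w.2 - w.1‖ < (1 - ‖w.1‖) / 2}} ∩ unitDisc ⊆
        Metric.ball ζ (2 * d) ∩ unitDisc := by
      rintro z ⟨hz, hzD⟩
      have h1 : ‖u - z‖ < (1 - ‖z‖) / 2 := hz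
      have h2 := norm_sub_norm_le u z
      have := mem_ball_of_dist_le hζ huζ hu1 (c := 1) (z := z) (by linarith)
      exact ⟨by rwa [show (1 + 1) * (1 - ‖u‖) = 2 * d by rw [hd]; ring] at this, hzD⟩
    calc ∫⁻ z in {z | (z, u) ∈ {w : ℂ × ℂ | ‖w.2 - w.1‖ < (1 - ‖w.1‖) / 2}} ∩ unitDisc,
          ENNReal.ofReal ((1 - ‖z‖) ^ (-(q + 1))) ∂ν
        ≤ ∫⁻ z in {z | (z, u) ∈ {w : ℂ × ℂ | ‖w.2 - w.1‖ < (1 - ‖w.1‖) / 2}} ∩ unitDisc,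
          ENNReal.ofReal (2 ^ (q + 1) * d ^ (-(q + 1))) ∂ν := by
          refine setLIntegral_mono measurable_const fun z hz => ENNReal.ofReal_le_ofReal ?_
          have h1 : ‖u - z‖ < (1 - ‖z‖) / 2 := hz.1
          have h2 := abs_le.1 (abs_norm_sub_norm_le u z)
          have h3 := mem_unitDisc.1 hz.2
          have h4 := rpow_le_of_comparable (x := 1 - ‖z‖) (y := d) (c := 2) (-(q + 1))
            (by linarith) two_pos (by linarith) (by linarith)
          rwa [abs_neg, abs_of_pos (by positivity)] at h4
      _ ≤ ENNReal.ofReal (2 ^ (q + 1) * d ^ (-(q + 1))) * ν (Metric.ball ζ (2 * d) ∩ unitDisc) := by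
          rw [lintegral_const, Measure.restrict_apply_univ]
          gcongr
      _ ≤ ENNReal.ofReal (2 ^ (q + 1) * d ^ (-(q + 1))) *
          (K * ENNReal.ofReal ((2 * d) ^ (q + 1))) := by
          gcongr
          exact hν ζ hζ _ (by positivity)
      _ = _ := by
          rw [mul_left_comm, ← ENNReal.ofReal_mul (by positivity), mul_comm (K : ℝ≥0∞)]
          congr 2
          rw [Real.mul_rpow (by norm_num) hd0.le, Real.rpow_neg hd0.le]
          have : d ^ (q + 1) ≠ 0 := by positivity
          field_simp
  · rw [zero_mul, add_zero, lintegral_mul_const _ hgm, mul_comm, weightedIntegral, ENNReal.coe_mul,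
      ENNReal.ofNNReal_toNNReal]
    congr 1
    · ring
    refine setLIntegral_congr_fun isOpen_unitDisc.measurableSet fun u hu => ?_
    simp only [indicator_of_mem hu]

/-- The oscillation part of the tent space embedding. -/
theorem exists_enorm_radial_sub_rpow_le_kernel {p q : ℝ} (hp : 0 < p) (hq : 0 < q) :
    ∃ C : ℝ≥0, ∀ f : ℂ → ℂ, DifferentiableOn ℂ f unitDisc → ∀ ζ : ℂ, ‖ζ‖ = 1 →
      ∀ a b : ℝ, 0 ≤ a → a ≤ b → b < 1 →
      ‖f (b * ζ) - f (a * ζ)‖ₑ ^ p ≤ C * ENNReal.ofReal ((1 - b) ^ (-(q / 2))) *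
        ∫⁻ u in {u | ‖u - b * ζ‖ < 4 * (1 - ‖u‖) ∧ 1 - ‖u‖ < 2 * (1 - a)},
          ‖deriv f u‖ₑ ^ p * ENNReal.ofReal ((1 - ‖u‖) ^ (p - 2 + q / 2)) ∂areaMeasure := by
  obtain ⟨C, hC⟩ := exists_enorm_rpow_mul_le_lintegral_ball hp (p - 2 + q / 2)
  -- This gives pε = q/2, strictly between 0 and q: the radial estimate needs ε > 0, and the later
  -- integration of (1 - |z|)^(-q/2) against a measure of order q + 1 needs q/2 < q.
  set ε := q / (2 * p) with hε
  have hε0 : 0 < ε := by positivity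
  have hpε : p * ε = q / 2 := by rw [hε]; field_simp
  refine ⟨Real.toNNReal (ε ^ (-p)) * C, fun f hf ζ hζ a b ha hab hb => ?_⟩
  have h1 := enorm_radial_sub_rpow_le hp hf hζ ha hab hb hε0
    (N := C * ∫⁻ u in {u | ‖u - b * ζ‖ < 4 * (1 - ‖u‖) ∧ 1 - ‖u‖ < 2 * (1 - a)},
          ‖deriv f u‖ₑ ^ p * ENNReal.ofReal ((1 - ‖u‖) ^ (p - 2 + q / 2)) ∂areaMeasure)
    fun t ht => ?_
  · rw [hpε] at h1
    refine h1.trans_eq ?_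
    rw [ENNReal.coe_mul, ENNReal.ofNNReal_toNNReal]
    ring
  · have ht0 : 0 ≤ t := ha.trans ht.1
    have ht1 : t < 1 := ht.2.trans_lt hb
    have hnorm : ‖(t : ℂ) * ζ‖ = t := by
      rw [norm_mul, hζ, mul_one, Complex.norm_real, Real.norm_of_nonneg ht0]
    have h2 := hC (deriv f) (hf.deriv isOpen_unitDisc) (t * ζ) (mem_unitDisc.2 (by rwa [hnorm]))
    rw [hnorm, show 2 + (p - 2 + q / 2) = p + p * ε by rw [hpε]; ring] at h2
    refine h2.trans ?_
    gcongr
    -- For t in [a, b] the disc about tζ satisfies |u - bζ| < 3(1 - t)/2 and (1 - t)/2 < 1 - |u| <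
    -- 3(1 - t)/2; the constants 4 and 2 leave slack.
    intro u hu
    rw [Metric.mem_ball, dist_eq_norm] at hu
    have h3 := abs_lt.1 ((abs_norm_sub_norm_le u (t * ζ)).trans_lt hu)
    rw [hnorm] at h3
    have h4 : ‖(t : ℂ) * ζ - b * ζ‖ = b - t := by
      rw [← sub_mul, norm_mul, hζ, mul_one, ← Complex.ofReal_sub, Complex.norm_real,
        Real.norm_of_nonpos (by linarith [ht.2])]
      ring
    have h5 := norm_sub_le_norm_sub_add_norm_sub u (t * ζ) (b * ζ)
    exact ⟨by linarith, by linarith [ht.1]⟩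

/-- The embedding of the Dirichlet type space into the tent space. -/
theorem exists_lintegral_carlesonSquare_le {p q : ℝ} (hp : 0 < p) (hq : 0 < q) :
    ∃ C : ℝ≥0, ∀ (ν : Measure ℂ) (K : ℝ≥0) (f : ℂ → ℂ), IsBallCarleson (q + 1) K ν →
      DifferentiableOn ℂ f unitDisc → ∀ θ : ℝ, ∀ ℓ ∈ Ioc (0 : ℝ) 1,
      ∫⁻ z in carlesonSquare θ ℓ, ‖f z‖ₑ ^ p ∂ν ≤
        C * K * (‖f 0‖ₑ ^ p + weightedIntegral p (p - 1) (deriv f)) * ENNReal.ofReal (ℓ ^ q) := by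
  obtain ⟨C₁, hC₁⟩ := exists_enorm_radial_sub_rpow_le_kernel hp hq
  obtain ⟨C₂, hC₂⟩ := exists_lintegral_boundary_dist_rpow_neg_le (s := q + 1) (b := q / 2)
    (by linarith)
  obtain ⟨C₃, hC₃⟩ := exists_enorm_rpow_le_of_deriv hp
  have h2p : (2 : ℝ≥0∞) ^ p ≠ ∞ := ENNReal.rpow_ne_top_of_nonneg hp.le (by simp)
  set A : ℝ≥0 := C₁ * C₂ * Real.toNNReal (5 ^ (q / 2 + 1) * 2 ^ q) with hA
  set A' : ℝ≥0 := C₃ * Real.toNNReal (6 ^ (q + 1)) with hA'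
  refine ⟨(2 ^ p : ℝ≥0∞).toNNReal * (A + A'), fun ν K f hν hf θ ℓ hℓ => ?_⟩
  have hℓ0 : 0 < ℓ := hℓ.1
  set J := weightedIntegral p (p - 1) (deriv f) with hJ
  set D := ‖f 0‖ₑ ^ p + J with hD
  have hdf := hf.deriv isOpen_unitDisc
  have hsq := carlesonSquare_subset_unitDisc θ hℓ.2
  have hsq' : carlesonSquare θ ℓ ⊆ Metric.ball (Complex.exp (θ * Complex.I)) (6 * ℓ) ∩ unitDisc :=
    fun z hz => ⟨dist_lt_of_mem_carlesonSquare hℓ0 hz, hsq hz⟩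
  have hνs : ν (carlesonSquare θ ℓ) ≤ K * ENNReal.ofReal ((6 * ℓ) ^ (q + 1)) :=
    (measure_mono hsq').trans (hν _ (Complex.norm_exp_ofReal_mul_I θ) _ (by positivity))
  have hpt : ∀ z ∈ carlesonSquare θ ℓ, ∃ ζ : ℂ, ‖ζ‖ = 1 ∧ z = ‖z‖ * ζ ∧ 1 - ℓ ≤ ‖z‖ := by
    rintro z ⟨r, ζ, ⟨t, -, rfl⟩, h1, h2, rfl⟩
    have h3 : ‖(r : ℂ) * Complex.exp (t * Complex.I)‖ = r := by
      rw [norm_mul, Complex.norm_exp_ofReal_mul_I, mul_one, Complex.norm_real,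
        Real.norm_of_nonneg (by linarith [hℓ.2])]
    exact ⟨Complex.exp (t * Complex.I), Complex.norm_exp_ofReal_mul_I t, by rw [h3], by rw [h3]; exact h1⟩
  -- No measurability of ζ is needed: it disappears from the final kernel bound, and only the
  -- dominating function has to be measurable.
  choose! ζ hζ1 hζ2 hζ3 using hpt
  -- Growth at the base point costs ℓ^(-1), while the square has mass O(ℓ^(q+1)); the product has
  -- the required order ℓ^q.
  set c : ℝ≥0∞ := ENNReal.ofReal ℓ⁻¹ * (C₃ * D) with hc
  have hbase : ∀ z ∈ carlesonSquare θ ℓ, ‖f (((1 - ℓ : ℝ) : ℂ) * ζ z)‖ₑ ^ p ≤ c := by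
    intro z hz
    have hn : ‖((1 - ℓ : ℝ) : ℂ) * ζ z‖ = 1 - ℓ := by
      rw [norm_mul, hζ1 z hz, mul_one, Complex.norm_real,
        Real.norm_of_nonneg (by linarith [hℓ.2])]
    have h1 := hC₃ f hf (((1 - ℓ : ℝ) : ℂ) * ζ z) (mem_unitDisc.2 (by rw [hn]; linarith))
    rw [hn, sub_sub_cancel] at h1
    calc _ = ENNReal.ofReal ℓ⁻¹ * (‖f (((1 - ℓ : ℝ) : ℂ) * ζ z)‖ₑ ^ p * ENNReal.ofReal ℓ) := by
          rw [mul_left_comm, ← ENNReal.ofReal_mul (by positivity),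
            inv_mul_cancel₀ hℓ0.ne', ENNReal.ofReal_one, mul_one]
      _ ≤ _ := mul_le_mul_right h1 _
  have hbase' : c * ν (carlesonSquare θ ℓ) ≤ A' * K * D * ENNReal.ofReal (ℓ ^ q) := by
    calc c * ν (carlesonSquare θ ℓ)
        ≤ c * (K * ENNReal.ofReal ((6 * ℓ) ^ (q + 1))) := by gcongr
      _ = C₃ * D * K * (ENNReal.ofReal ℓ⁻¹ * ENNReal.ofReal ((6 * ℓ) ^ (q + 1))) := by ring
      _ = _ := by
          rw [← ENNReal.ofReal_mul (by positivity),
            show ℓ⁻¹ * (6 * ℓ) ^ (q + 1) = 6 ^ (q + 1) * ℓ ^ q by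
              rw [Real.mul_rpow (by norm_num) hℓ0.le, Real.rpow_add_one hℓ0.ne']
              field_simp,
            ENNReal.ofReal_mul (by positivity), hA', ENNReal.coe_mul, ENNReal.ofNNReal_toNNReal]
          ring
  have hfz : ∀ z, ‖f z‖ₑ ^ p ≤ 2 ^ p * (‖f z - f (((1 - ℓ : ℝ) : ℂ) * ζ z)‖ₑ ^ p +
      ‖f (((1 - ℓ : ℝ) : ℂ) * ζ z)‖ₑ ^ p) := by
    intro z
    have h1 := enorm_add_le (f z - f (((1 - ℓ : ℝ) : ℂ) * ζ z)) (f (((1 - ℓ : ℝ) : ℂ) * ζ z))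
    rw [sub_add_cancel] at h1
    exact (ENNReal.rpow_le_rpow h1 hp.le).trans (add_rpow_le_two_rpow_mul hp.le _ _)
  set S : Set ℂ := {u | 1 - ‖u‖ < 2 * ℓ} with hS
  have hSm : MeasurableSet S := measurableSet_lt (by fun_prop) (by fun_prop)
  set R : Set (ℂ × ℂ) := {w | ‖w.2 - w.1‖ < 4 * (1 - ‖w.2‖)} with hR
  set G : ℂ → ℝ≥0∞ := S.indicator fun u => ‖unitDisc.indicator (deriv f) u‖ₑ ^ p *
    ENNReal.ofReal ((1 - ‖u‖) ^ (p - 2 + q / 2)) with hG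
  -- In `B`, the exponent is (q + 1) - q/2 and 5 = 4 + 1 is the radius given by
  -- `mem_ball_of_dist_le`.
  refine (setLIntegral_le_of_kernel hν.measure_unitDisc_lt_top hsq (2 ^ p * c)
    (R := R) (G := G)
    (H := fun z => 2 ^ p * (C₁ * ENNReal.ofReal ((1 - ‖z‖) ^ (-(q / 2)))))
    (B := fun u => 2 ^ p * (C₁ * (C₂ * K * ENNReal.ofReal ((5 * (1 - ‖u‖)) ^ (q / 2 + 1)))))
    (measurableSet_lt (by fun_prop) (by fun_prop))
    ((measurable_indicator_mul_weight hdf _).indicator hSm) (by fun_prop) ?_ ?_).trans ?_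
  · intro z hz
    have hz1 := mem_unitDisc.1 (hsq hz)
    have h1 := hC₁ f hf (ζ z) (hζ1 z hz) (1 - ℓ) ‖z‖ (by linarith [hℓ.2]) (hζ3 z hz) hz1
    rw [← hζ2 z hz, sub_sub_cancel] at h1
    refine (hfz z).trans ?_
    rw [mul_add, mul_assoc]
    refine add_le_add (mul_le_mul_right (h1.trans_eq ?_) _) (mul_le_mul_right (hbase z hz) _)
    congr 1
    have hTm : MeasurableSet {u : ℂ | ‖u - z‖ < 4 * (1 - ‖u‖) ∧ 1 - ‖u‖ < 2 * ℓ} :=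
      (measurableSet_lt (f := fun u : ℂ => ‖u - z‖) (by fun_prop) (by fun_prop)).inter hSm
    have hTD : {u : ℂ | ‖u - z‖ < 4 * (1 - ‖u‖) ∧ 1 - ‖u‖ < 2 * ℓ} ⊆ unitDisc :=
      fun u hu => mem_unitDisc.2 (by linarith [hu.1, norm_nonneg (u - z)])
    rw [← inter_eq_left.2 hTD, ← Measure.restrict_restrict hTm, ← lintegral_indicator hTm]
    refine setLIntegral_congr_fun isOpen_unitDisc.measurableSet fun u hu => ?_
    by_cases hu1 : ‖u - z‖ < 4 * (1 - ‖u‖) <;> by_cases hu2 : 1 - ‖u‖ < 2 * ℓ <;>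
      simp [hR, hG, hS, hu, hu1, hu2]
  · intro u hu
    have hu1 := mem_unitDisc.1 hu
    obtain ⟨η, hη, huη⟩ := exists_unit_mul_norm u
    rw [lintegral_const_mul' _ _ h2p, lintegral_const_mul' _ _ ENNReal.coe_ne_top]
    gcongr
    have h1 := hC₂ ν K hν η hη (5 * (1 - ‖u‖)) (by linarith)
    rw [show q + 1 - q / 2 = q / 2 + 1 by ring] at h1
    refine (lintegral_mono_set ?_).trans h1
    rintro z ⟨hz, hzD⟩
    have := mem_ball_of_dist_le hη huη hu1 hz
    exact ⟨by rwa [show (4 + 1 : ℝ) = 5 by norm_num] at this, hzD⟩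
  · have h1 : ∀ u ∈ unitDisc, G u * (2 ^ p * (C₁ * (C₂ * K * ENNReal.ofReal ((5 * (1 - ‖u‖)) ^ (q / 2 + 1)))))
        ≤ 2 ^ p * A * K * ENNReal.ofReal (ℓ ^ q) *
          (‖deriv f u‖ₑ ^ p * ENNReal.ofReal ((1 - ‖u‖) ^ (p - 1))) := by
      intro u hu
      have hu0 : 0 < 1 - ‖u‖ := by linarith [mem_unitDisc.1 hu]
      by_cases huS : u ∈ S
      · rw [hG, indicator_of_mem huS, indicator_of_mem hu]
        have huS' : 1 - ‖u‖ ≤ 2 * ℓ := le_of_lt huS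
        -- The total exponent is q + (p - 1). The surplus power q is at most (2ℓ)^q on the truncated
        -- region, and this is the source of ℓ^q.
        have h2 : (1 - ‖u‖) ^ (p - 2 + q / 2) * (5 * (1 - ‖u‖)) ^ (q / 2 + 1) ≤
            5 ^ (q / 2 + 1) * 2 ^ q * (ℓ ^ q * (1 - ‖u‖) ^ (p - 1)) := by
          rw [Real.mul_rpow (by norm_num) hu0.le, mul_left_comm, ← Real.rpow_add hu0,
            show p - 2 + q / 2 + (q / 2 + 1) = q + (p - 1) by ring, Real.rpow_add hu0,
            mul_assoc, ← mul_assoc (2 ^ q), ← Real.mul_rpow (by norm_num) hℓ0.le]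
          gcongr
        calc _ = 2 ^ p * C₁ * C₂ * K * ‖deriv f u‖ₑ ^ p *
              ENNReal.ofReal ((1 - ‖u‖) ^ (p - 2 + q / 2) * (5 * (1 - ‖u‖)) ^ (q / 2 + 1)) := by
              rw [ENNReal.ofReal_mul (by positivity)]
              ring
          _ ≤ 2 ^ p * C₁ * C₂ * K * ‖deriv f u‖ₑ ^ p *
              ENNReal.ofReal (5 ^ (q / 2 + 1) * 2 ^ q * (ℓ ^ q * (1 - ‖u‖) ^ (p - 1))) := by
              gcongr
          _ = _ := by
              rw [ENNReal.ofReal_mul (p := 5 ^ (q / 2 + 1) * 2 ^ q) (by positivity),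
                ENNReal.ofReal_mul (p := ℓ ^ q) (by positivity), hA, ENNReal.coe_mul, ENNReal.coe_mul, ENNReal.ofNNReal_toNNReal]
              ring
      · rw [hG, indicator_of_notMem huS, zero_mul]
        exact zero_le
    have h3 := setLIntegral_mono' (μ := areaMeasure) isOpen_unitDisc.measurableSet h1
    rw [lintegral_const_mul' _ _ (by finiteness), ← weightedIntegral, ← hJ] at h3
    calc _ ≤ 2 ^ p * A * K * ENNReal.ofReal (ℓ ^ q) * J + 2 ^ p * c * ν (carlesonSquare θ ℓ) := by
          gcongr
      _ ≤ 2 ^ p * A * K * ENNReal.ofReal (ℓ ^ q) * D +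
          2 ^ p * (A' * K * D * ENNReal.ofReal (ℓ ^ q)) := by
          rw [mul_assoc (2 ^ p) c]
          gcongr
          exact le_add_self
      _ = _ := by
          have h4 : ∀ B B' : ℝ≥0, (((2 ^ p : ℝ≥0∞).toNNReal * (B + B') : ℝ≥0) : ℝ≥0∞) =
              2 ^ p * (B + B') := fun B B' => by
            rw [ENNReal.coe_mul, ENNReal.coe_toNNReal h2p, ENNReal.coe_add]
          rw [h4]
          ring

/-! ### Normal families in the Bergman and Dirichlet spaces -/

theorem aemeasurable_weighted {p : ℝ} {g : ℂ → ℂ} (hg : DifferentiableOn ℂ g unitDisc) (γ : ℝ) :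
    AEMeasurable (fun u => ‖g u‖ₑ ^ p * ENNReal.ofReal ((1 - ‖u‖) ^ γ))
      (areaMeasure.restrict unitDisc) := by
  refine (measurable_indicator_mul_weight (p := p) hg γ).aemeasurable.congr ?_
  refine (ae_restrict_iff' isOpen_unitDisc.measurableSet).2 (.of_forall fun u hu => ?_)
  simp only [indicator_of_mem hu]

theorem weightedIntegral_sub_le {p : ℝ} (hp : 0 ≤ p) (α : ℝ) {f g : ℂ → ℂ}
    (hf : DifferentiableOn ℂ f unitDisc) :
    weightedIntegral p α (fun z => f z - g z) ≤
      2 ^ p * (weightedIntegral p α f + weightedIntegral p α g) := by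
  have h2p : (2 : ℝ≥0∞) ^ p ≠ ∞ := ENNReal.rpow_ne_top_of_nonneg hp (by simp)
  rw [weightedIntegral, weightedIntegral, weightedIntegral,
    ← lintegral_add_left' (aemeasurable_weighted hf α), ← lintegral_const_mul' _ _ h2p]
  refine lintegral_mono fun z => ?_
  rw [← add_mul, ← mul_assoc]
  gcongr
  refine le_trans ?_ (add_rpow_le_two_rpow_mul hp _ _)
  gcongr
  exact enorm_sub_le

theorem weightedIntegral_congr {p α : ℝ} {f g : ℂ → ℂ} (h : EqOn f g unitDisc) :
    weightedIntegral p α f = weightedIntegral p α g :=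
  setLIntegral_congr_fun isOpen_unitDisc.measurableSet fun z hz => by simp only [h hz]

theorem weightedIntegral_le_of_tendsto (p α : ℝ) {f : ℕ → ℂ → ℂ} {g : ℂ → ℂ}
    (hf : ∀ n, DifferentiableOn ℂ (f n) unitDisc)
    (hlim : ∀ z ∈ unitDisc, Tendsto (fun n => f n z) atTop (𝓝 (g z))) {B : ℝ≥0∞}
    (hB : ∀ n, weightedIntegral p α (f n) ≤ B) : weightedIntegral p α g ≤ B := by
  calc weightedIntegral p α g
      = ∫⁻ z in unitDisc, liminf (fun n => ‖f n z‖ₑ ^ p * ENNReal.ofReal ((1 - ‖z‖) ^ α)) atTop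
          ∂areaMeasure := by
        refine setLIntegral_congr_fun isOpen_unitDisc.measurableSet fun z hz => ?_
        refine (Tendsto.liminf_eq ?_).symm
        refine ENNReal.Tendsto.mul_const ?_ (Or.inr ENNReal.ofReal_ne_top)
        exact ((ENNReal.continuous_rpow_const (y := p)).tendsto _).comp (hlim z hz).enorm
    _ ≤ liminf (fun n => weightedIntegral p α (f n)) atTop :=
        lintegral_liminf_le' fun n => aemeasurable_weighted (hf n) α
    _ ≤ B := by
        refine liminf_le_of_le (by isBoundedDefault) fun b hb => ?_
        obtain ⟨n, hn⟩ := hb.exists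
        exact hn.trans (hB n)

/-- `f ↦ N f` behaves like the `p`-th power of a quasi-norm on a space of analytic functions on the
unit disc in which point evaluations are bounded. -/
structure IsAnalyticSize (p : ℝ) (N : (ℂ → ℂ) → ℝ≥0∞) : Prop where
  pointwise : ∃ (C : ℝ≥0) (β : ℝ), 0 ≤ β ∧ ∀ f : ℂ → ℂ, DifferentiableOn ℂ f unitDisc →
    ∀ z ∈ unitDisc, ‖f z‖ₑ ^ p * ENNReal.ofReal ((1 - ‖z‖) ^ β) ≤ C * N f
  sub_le : ∀ f g : ℂ → ℂ, DifferentiableOn ℂ f unitDisc → DifferentiableOn ℂ g unitDisc →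
    N (fun z => f z - g z) ≤ 2 ^ p * (N f + N g)
  fatou : ∀ (f : ℕ → ℂ → ℂ) (g : ℂ → ℂ) (B : ℝ≥0∞), (∀ n, DifferentiableOn ℂ (f n) unitDisc) →
    TendstoLocallyUniformlyOn f g atTop unitDisc → (∀ n, N (f n) ≤ B) → N g ≤ 2 * B

theorem isAnalyticSize_bergman {p q : ℝ} (hp : 0 < p) (hq : 0 < q) :
    IsAnalyticSize p (weightedIntegral p (q - 1)) where
  pointwise := by
    obtain ⟨C, hC⟩ := exists_enorm_rpow_le_weightedIntegral hp (q - 1)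
    exact ⟨C, 2 + (q - 1), by linarith, hC⟩
  sub_le _ _ hf _ := weightedIntegral_sub_le hp.le _ hf
  fatou _ _ B hf hlim hB :=
    (weightedIntegral_le_of_tendsto p _ hf (fun _ hz => hlim.tendsto_at hz) hB).trans
      (le_mul_of_one_le_left' one_le_two)

theorem isAnalyticSize_dirichlet {p : ℝ} (hp : 0 < p) :
    IsAnalyticSize p fun f => ‖f 0‖ₑ ^ p + weightedIntegral p (p - 1) (deriv f) where
  pointwise := by
    obtain ⟨C, hC⟩ := exists_enorm_rpow_le_of_deriv hp
    exact ⟨C, 1, zero_le_one, fun f hf z hz => by simpa using hC f hf z hz⟩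
  sub_le f g hf hg := by
    have h1 : EqOn (deriv fun z => f z - g z) (fun z => deriv f z - deriv g z) unitDisc :=
      fun z hz => deriv_fun_sub (hf.differentiableAt (isOpen_unitDisc.mem_nhds hz))
        (hg.differentiableAt (isOpen_unitDisc.mem_nhds hz))
    have h2 : ‖f 0 - g 0‖ₑ ^ p ≤ 2 ^ p * (‖f 0‖ₑ ^ p + ‖g 0‖ₑ ^ p) :=
      (ENNReal.rpow_le_rpow enorm_sub_le hp.le).trans (add_rpow_le_two_rpow_mul hp.le _ _)
    have h3 := weightedIntegral_sub_le (g := deriv g) hp.le (p - 1) (hf.deriv isOpen_unitDisc)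
    rw [weightedIntegral_congr h1]
    refine (add_le_add h2 h3).trans_eq ?_
    ring
  fatou f g B hf hlim hB := by
    have hd := hlim.deriv (.of_forall hf) isOpen_unitDisc
    have h0 : Tendsto (fun n => ‖f n 0‖ₑ ^ p) atTop (𝓝 (‖g 0‖ₑ ^ p)) :=
      ((ENNReal.continuous_rpow_const (y := p)).tendsto _).comp
        (hlim.tendsto_at (mem_unitDisc.2 (by simp))).enorm
    have h1 := weightedIntegral_le_of_tendsto p (p - 1)
      (fun n => (hf n).deriv isOpen_unitDisc) (fun z hz => hd.tendsto_at hz)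
      fun n => le_add_self.trans (hB n)
    -- Each of the two summands is bounded by B on its own, which accounts for the factor 2 in
    -- `fatou`.
    rw [two_mul]
    exact add_le_add (le_of_tendsto' h0 fun n => le_self_add.trans (hB n)) h1

/-- Bounded point evaluations give uniform bounds on smaller discs, hence Montel applies; the Fatou
property controls the limit. -/
theorem IsAnalyticSize.exists_subseq {p : ℝ} (hp : 0 < p) {N : (ℂ → ℂ) → ℝ≥0∞}
    (hN : IsAnalyticSize p N) {f : ℕ → ℂ → ℂ} (hf : ∀ n, DifferentiableOn ℂ (f n) unitDisc)
    {B : ℝ≥0} (hB : ∀ n, N (f n) ≤ B) :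
    ∃ g : ℂ → ℂ, DifferentiableOn ℂ g unitDisc ∧ N g ≤ 2 * B ∧ ∃ φ : ℕ → ℕ, StrictMono φ ∧
      TendstoLocallyUniformlyOn (fun n => f (φ n)) g atTop unitDisc := by
  obtain ⟨C, β, hβ, hC⟩ := hN.pointwise
  obtain ⟨g, hg, φ, hφ, hlim⟩ := exists_subseq_tendstoLocallyUniformlyOn hf
    (M := fun r => ((C * B : ℝ≥0) * (1 - r) ^ (-β)) ^ (1 / p)) fun r hr n z hz => by
      have hr0 : 0 < 1 - r := by linarith
      have hz0 : 0 < 1 - ‖z‖ := by linarith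
      have h1 := (hC (f n) (hf n) z (mem_unitDisc.2 (by linarith))).trans
        (mul_le_mul_right (hB n) _)
      rw [enorm_rpow_eq_ofReal hp.le, ← ENNReal.ofReal_mul (by positivity), ← ENNReal.coe_mul,
        ENNReal.ofReal_le_iff_le_toReal ENNReal.coe_ne_top, ENNReal.coe_toReal] at h1
      rw [one_div, Real.le_rpow_inv_iff_of_pos (norm_nonneg _) (by positivity) hp,
        Real.rpow_neg hr0.le, ← div_eq_mul_inv, le_div_iff₀ (by positivity)]
      refine le_trans ?_ h1
      gcongr
  exact ⟨g, hg, hN.fatou _ _ _ (fun n => hf _) hlim fun n => hB _, φ, hφ, hlim⟩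

/-! ### Compactness from the vanishing condition -/

/-- Uniform decay of the integrals of a bounded sequence that tends to zero locally uniformly, over
a family of sets on which a Carleson embedding holds. -/
theorem eventually_setLIntegral_le_of_vanishing {p s : ℝ} (hp : 0 < p) (hs : 1 ≤ s)
    {μ : Measure ℂ} (hμ : IsVanishingCarlesonMeasure s μ) {ι : Type*} {S : ι → Set ℂ}
    {c : ι → ℝ≥0∞} (hS : ∀ i, S i ⊆ unitDisc)
    (hc : ∀ r < 1, ∃ m : ℝ≥0∞, m ≠ 0 ∧ ∀ i, (S i ∩ {z | ‖z‖ ≤ r}).Nonempty → m ≤ c i)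
    {N : (ℂ → ℂ) → ℝ≥0∞} {C : ℝ≥0}
    (hC : ∀ (ν : Measure ℂ) (K : ℝ≥0) (f : ℂ → ℂ), IsBallCarleson s K ν →
      DifferentiableOn ℂ f unitDisc → ∀ i, ∫⁻ z in S i, ‖f z‖ₑ ^ p ∂ν ≤ C * K * N f * c i)
    {h : ℕ → ℂ → ℂ} (hh : ∀ n, DifferentiableOn ℂ (h n) unitDisc) {B : ℝ≥0}
    (hB : ∀ n, N (h n) ≤ B) (hlim : TendstoLocallyUniformlyOn h 0 atTop unitDisc)
    {ε : ℝ≥0} (hε : 0 < ε) :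
    ∀ᶠ n in atTop, ∀ i, ∫⁻ z in S i, ‖h n z‖ₑ ^ p ∂μ ≤ ε * c i := by
  obtain ⟨K, hK⟩ := hμ.1.exists_isBallCarleson (by linarith)
  set η : ℝ≥0 := ε / (2 * (C * B + 1)) with hη
  have hη0 : 0 < η := by positivity
  have hηε : C * η * B ≤ ε / 2 := by
    rw [hη, ← NNReal.coe_le_coe]
    push_cast
    rw [mul_div_assoc', div_mul_eq_mul_div, div_le_div_iff₀ (by positivity) (by positivity)]
    have : (0 : ℝ) ≤ ε := ε.2
    nlinarith
  obtain ⟨r, hr0, hr1, hr⟩ := hμ.exists_isBallCarleson_restrict hs hη0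
  -- The inner part |z| ≤ r is estimated by an absolute quantity. This is uniform in i because a set
  -- reaching into |z| ≤ r has c i bounded below.
  obtain ⟨m, hm0, hm⟩ := hc r hr1
  have hD : μ unitDisc ≠ ∞ := hK.measure_unitDisc_lt_top.ne
  obtain ⟨δ, hδ0, hδ⟩ : ∃ δ : ℝ, 0 < δ ∧ ENNReal.ofReal (δ ^ p) * μ unitDisc ≤ (ε / 2 : ℝ≥0) * m := by
    have h1 : Tendsto (fun δ : ℝ => ENNReal.ofReal (δ ^ p) * μ unitDisc) (𝓝[>] 0) (𝓝 0) := by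
      have h2 : Tendsto (fun δ : ℝ => ENNReal.ofReal (δ ^ p)) (𝓝 0) (𝓝 0) := by
        have := ENNReal.tendsto_ofReal ((Real.continuous_rpow_const hp.le).tendsto (0 : ℝ))
        simpa [Real.zero_rpow hp.ne'] using this
      have := ENNReal.Tendsto.mul_const (h2.mono_left (nhdsWithin_le_nhds (s := Ioi 0))) (Or.inr hD)
      simpa using this
    have hpos : 0 < ((ε / 2 : ℝ≥0) : ℝ≥0∞) * m :=
      ENNReal.mul_pos (by exact_mod_cast (by positivity : ε / 2 ≠ 0)) hm0
    obtain ⟨δ, hδ1, hδ2⟩ := ((h1.eventually_lt_const hpos).and self_mem_nhdsWithin).exists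
    exact ⟨δ, hδ2, hδ1.le⟩
  have hunif : TendstoUniformlyOn h 0 atTop (Metric.closedBall 0 r) :=
    (tendstoLocallyUniformlyOn_iff_forall_isCompact isOpen_unitDisc).1 hlim _
      (Metric.closedBall_subset_ball hr1) (isCompact_closedBall 0 r)
  filter_upwards [Metric.tendstoUniformlyOn_iff.1 hunif δ hδ0] with n hn i
  have hVm : MeasurableSet {z : ℂ | r < ‖z‖} := measurableSet_lt measurable_const measurable_norm
  rw [← lintegral_inter_add_sdiff _ (S i) hVm]
  have h1 : ∫⁻ z in S i ∩ {z : ℂ | r < ‖z‖}, ‖h n z‖ₑ ^ p ∂μ ≤ (ε / 2 : ℝ≥0) * c i := by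
    have h2 := hC _ _ (h n) hr (hh n) i
    rw [Measure.restrict_restrict' hVm] at h2
    refine h2.trans ?_
    gcongr
    calc (C : ℝ≥0∞) * η * N (h n) ≤ C * η * B := by gcongr; exact hB n
      _ ≤ _ := by exact_mod_cast hηε
  have h2 : ∫⁻ z in S i \ {z : ℂ | r < ‖z‖}, ‖h n z‖ₑ ^ p ∂μ ≤ (ε / 2 : ℝ≥0) * c i := by
    have hset : S i \ {z : ℂ | r < ‖z‖} = S i ∩ {z | ‖z‖ ≤ r} := by
      ext z
      simp
    rw [hset]
    rcases (S i ∩ {z | ‖z‖ ≤ r}).eq_empty_or_nonempty with he | hne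
    · simp [he]
    · calc ∫⁻ z in S i ∩ {z | ‖z‖ ≤ r}, ‖h n z‖ₑ ^ p ∂μ
          ≤ ∫⁻ z in S i ∩ {z | ‖z‖ ≤ r}, ENNReal.ofReal (δ ^ p) ∂μ := by
            refine setLIntegral_mono measurable_const fun z hz => ?_
            have h3 := hn z (by simpa using hz.2)
            rw [Pi.zero_apply, dist_zero_left] at h3
            rw [enorm_rpow_eq_ofReal hp.le]
            gcongr
        _ ≤ ENNReal.ofReal (δ ^ p) * μ unitDisc := by
            rw [lintegral_const, Measure.restrict_apply_univ]
            gcongr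
            exact inter_subset_left.trans (hS i)
        _ ≤ (ε / 2 : ℝ≥0) * m := hδ
        _ ≤ _ := by
            gcongr
            exact hm i hne
  refine (add_le_add h1 h2).trans_eq ?_
  rw [← add_mul, ← ENNReal.coe_add, add_halves]

/-- The decay estimate is applied to the differences f (φ n) - g, bounded by the quasi-triangle
inequality. Taking S to be the disc gives L^p(μ); taking all Carleson squares with c = ℓ^q gives the
tent space. -/
theorem exists_compact_of_vanishing {p s : ℝ} (hp : 0 < p) (hs : 1 ≤ s)
    {μ : Measure ℂ} (hμ : IsVanishingCarlesonMeasure s μ) {ι : Type*} {S : ι → Set ℂ}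
    {c : ι → ℝ≥0∞} (hS : ∀ i, S i ⊆ unitDisc)
    (hc : ∀ r < 1, ∃ m : ℝ≥0∞, m ≠ 0 ∧ ∀ i, (S i ∩ {z | ‖z‖ ≤ r}).Nonempty → m ≤ c i)
    {N : (ℂ → ℂ) → ℝ≥0∞} (hN : IsAnalyticSize p N) {C : ℝ≥0}
    (hC : ∀ (ν : Measure ℂ) (K : ℝ≥0) (f : ℂ → ℂ), IsBallCarleson s K ν →
      DifferentiableOn ℂ f unitDisc → ∀ i, ∫⁻ z in S i, ‖f z‖ₑ ^ p ∂ν ≤ C * K * N f * c i)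
    {f : ℕ → ℂ → ℂ} (hf : ∀ n, DifferentiableOn ℂ (f n) unitDisc) {B : ℝ≥0}
    (hB : ∀ n, N (f n) ≤ B) :
    ∃ g : ℂ → ℂ, DifferentiableOn ℂ g unitDisc ∧ N g < ∞ ∧ ∃ φ : ℕ → ℕ, StrictMono φ ∧
      ∀ ε : ℝ≥0, 0 < ε → ∀ᶠ n in atTop, ∀ i,
        ∫⁻ z in S i, ‖f (φ n) z - g z‖ₑ ^ p ∂μ ≤ ε * c i := by
  obtain ⟨g, hg, hNg, φ, hφ, hlim⟩ := hN.exists_subseq hp hf hB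
  have hNg' : N g < ∞ := hNg.trans_lt (by finiteness)
  refine ⟨g, hg, hNg', φ, hφ, fun ε hε => ?_⟩
  have hfin : (2 : ℝ≥0∞) ^ p * (B + N g) ≠ ∞ :=
    ENNReal.mul_ne_top (ENNReal.rpow_ne_top_of_nonneg hp.le (by simp))
      (ENNReal.add_ne_top.2 ⟨ENNReal.coe_ne_top, hNg'.ne⟩)
  refine eventually_setLIntegral_le_of_vanishing hp hs hμ hS hc hC
    (h := fun n z => f (φ n) z - g z) (fun n => (hf _).sub hg)
    (B := ((2 : ℝ≥0∞) ^ p * (B + N g)).toNNReal) (fun n => ?_) ?_ hε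
  · rw [ENNReal.coe_toNNReal hfin]
    refine (hN.sub_le _ _ (hf _) hg).trans ?_
    gcongr
    exact hB _
  · rw [Metric.tendstoLocallyUniformlyOn_iff] at hlim ⊢
    intro δ hδ x hx
    obtain ⟨t, ht, h⟩ := hlim δ hδ x hx
    refine ⟨t, ht, h.mono fun n hn y hy => ?_⟩
    have := hn y hy
    rw [dist_comm, dist_eq_norm] at this
    rwa [Pi.zero_apply, dist_zero_left]

/-! ### Comparison of norms and the implications from the vanishing condition -/

/-- On the disc 1 - |z| ≤ 1 - |z|² ≤ 2(1 - |z|). -/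
theorem lintegral_weight_comparison (α : ℝ) (F : ℂ → ℝ≥0∞) :
    (∫⁻ z in unitDisc, F z * ENNReal.ofReal ((1 - ‖z‖) ^ α) ∂areaMeasure ≤
      ENNReal.ofReal (2 ^ |α|) *
        ∫⁻ z in unitDisc, F z * ENNReal.ofReal ((1 - ‖z‖ ^ 2) ^ α) ∂areaMeasure) ∧
    ∫⁻ z in unitDisc, F z * ENNReal.ofReal ((1 - ‖z‖ ^ 2) ^ α) ∂areaMeasure ≤
      ENNReal.ofReal (2 ^ |α|) *
        ∫⁻ z in unitDisc, F z * ENNReal.ofReal ((1 - ‖z‖) ^ α) ∂areaMeasure := by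
  constructor <;>
  · rw [← lintegral_const_mul' _ _ ENNReal.ofReal_ne_top]
    refine setLIntegral_mono' isOpen_unitDisc.measurableSet fun z hz => ?_
    rw [mul_left_comm, ← ENNReal.ofReal_mul (by positivity)]
    have h1 := mem_unitDisc.1 hz
    have h2 := norm_nonneg z
    gcongr
    exact rpow_le_of_comparable α (by nlinarith) two_pos (by nlinarith) (by nlinarith)

theorem bergmanNorm_rpow {p α : ℝ} (hp : 0 < p) (hα : -1 < α) (f : ℂ → ℂ) :
    bergmanNorm p α f ^ p = ENNReal.ofReal (α + 1) *
      ∫⁻ z in unitDisc, ‖f z‖ₑ ^ p * ENNReal.ofReal ((1 - ‖z‖ ^ 2) ^ α) ∂areaMeasure := by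
  rw [bergmanNorm, ← ENNReal.rpow_mul, one_div_mul_cancel hp.ne', ENNReal.rpow_one,
    ← lintegral_const_mul' _ _ ENNReal.ofReal_ne_top]
  refine lintegral_congr fun z => ?_
  rw [ENNReal.ofReal_mul (by linarith)]
  ring

theorem exists_weightedIntegral_le_bergmanNorm {p α : ℝ} (hp : 0 < p) (hα : -1 < α) :
    ∃ C : ℝ≥0, ∀ f, weightedIntegral p α f ≤ C * bergmanNorm p α f ^ p := by
  have hα0 : 0 < α + 1 := by linarith
  refine ⟨Real.toNNReal (2 ^ |α| * (α + 1)⁻¹), fun f => ?_⟩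
  refine (lintegral_weight_comparison α _).1.trans_eq ?_
  rw [bergmanNorm_rpow hp hα, ENNReal.ofNNReal_toNNReal, ← mul_assoc,
    ← ENNReal.ofReal_mul (by positivity), inv_mul_cancel_right₀ hα0.ne']

theorem exists_bergmanNorm_le_weightedIntegral {p α : ℝ} (hp : 0 < p) (hα : -1 < α) :
    ∃ C : ℝ≥0, ∀ f, bergmanNorm p α f ^ p ≤ C * weightedIntegral p α f := by
  refine ⟨Real.toNNReal ((α + 1) * 2 ^ |α|), fun f => ?_⟩
  rw [bergmanNorm_rpow hp hα, ENNReal.ofNNReal_toNNReal, ENNReal.ofReal_mul (by linarith), mul_assoc]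
  gcongr
  exact (lintegral_weight_comparison α _).2

theorem dirichletNorm_rpow {p : ℝ} (hp : 0 < p) (f : ℂ → ℂ) :
    dirichletNorm p f ^ p = ‖f 0‖ₑ ^ p + ∫⁻ z in unitDisc,
      ‖deriv f z‖ₑ ^ p * ENNReal.ofReal ((1 - ‖z‖ ^ 2) ^ (p - 1)) ∂areaMeasure := by
  rw [dirichletNorm, ← ENNReal.rpow_mul, one_div_mul_cancel hp.ne', ENNReal.rpow_one]

theorem one_le_ofReal_two_rpow_abs (α : ℝ) : 1 ≤ ENNReal.ofReal (2 ^ |α|) := by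
  rw [← ENNReal.ofReal_one]
  exact ENNReal.ofReal_le_ofReal (Real.one_le_rpow one_le_two (abs_nonneg α))

theorem exists_le_dirichletNorm {p : ℝ} (hp : 0 < p) :
    ∃ C : ℝ≥0, ∀ f, ‖f 0‖ₑ ^ p + weightedIntegral p (p - 1) (deriv f) ≤
      C * dirichletNorm p f ^ p := by
  refine ⟨Real.toNNReal (2 ^ |p - 1|), fun f => ?_⟩
  rw [dirichletNorm_rpow hp, ENNReal.ofNNReal_toNNReal, mul_add]
  exact add_le_add (le_mul_of_one_le_left' (one_le_ofReal_two_rpow_abs _))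
    (lintegral_weight_comparison _ _).1

theorem exists_dirichletNorm_le {p : ℝ} (hp : 0 < p) :
    ∃ C : ℝ≥0, ∀ f, dirichletNorm p f ^ p ≤
      C * (‖f 0‖ₑ ^ p + weightedIntegral p (p - 1) (deriv f)) := by
  refine ⟨Real.toNNReal (2 ^ |p - 1|), fun f => ?_⟩
  rw [dirichletNorm_rpow hp, ENNReal.ofNNReal_toNNReal, mul_add]
  exact add_le_add (le_mul_of_one_le_left' (one_le_ofReal_two_rpow_abs _))
    (lintegral_weight_comparison _ _).2

theorem lebesgueNorm_eq {p : ℝ} (hp : 0 < p) {μ : Measure ℂ} (hμ : μ unitDiscᶜ = 0) (f : ℂ → ℂ) :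
    lebesgueNorm p μ f = (∫⁻ z in unitDisc, ‖f z‖ₑ ^ p ∂μ) ^ (1 / p) := by
  have h : μ.restrict unitDisc = μ := Measure.restrict_eq_self_of_ae_mem (mem_ae_iff.2 hμ)
  rw [lebesgueNorm, eLpNorm_eq_lintegral_rpow_enorm_toReal (by simpa using hp) ENNReal.ofReal_ne_top,
    ENNReal.toReal_ofReal hp.le, h]

theorem aestronglyMeasurable_of_differentiableOn {μ : Measure ℂ} (hμ : μ unitDiscᶜ = 0) {f : ℂ → ℂ}
    (hf : DifferentiableOn ℂ f unitDisc) : AEStronglyMeasurable f μ := by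
  have h : μ.restrict unitDisc = μ := Measure.restrict_eq_self_of_ae_mem (mem_ae_iff.2 hμ)
  rw [← h]
  exact hf.continuousOn.aestronglyMeasurable isOpen_unitDisc.measurableSet

theorem one_sub_le_norm_of_mem_carlesonSquare {θ ℓ : ℝ} (hℓ : ℓ ≤ 1) {z : ℂ}
    (hz : z ∈ carlesonSquare θ ℓ) : 1 - ℓ ≤ ‖z‖ := by
  obtain ⟨r, ζ, ⟨t, -, rfl⟩, h1, h2, rfl⟩ := hz
  rwa [norm_mul, Complex.norm_exp_ofReal_mul_I, mul_one, Complex.norm_real,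
    Real.norm_of_nonneg (by linarith)]

theorem tendsto_zero_of_forall_eventually_le_rpow {p : ℝ} (hp : 0 < p) {u : ℕ → ℝ≥0∞}
    (h : ∀ ε : ℝ≥0, 0 < ε → ∀ᶠ n in atTop, u n ≤ (ε : ℝ≥0∞) ^ (1 / p)) :
    Tendsto u atTop (𝓝 0) := by
  rw [ENNReal.tendsto_nhds_zero]
  intro δ hδ
  rcases eq_or_ne δ ∞ with rfl | hδt
  · exact .of_forall fun _ => le_top
  lift δ to ℝ≥0 using hδt
  have hδ0 : 0 < δ := by exact_mod_cast hδ
  refine (h (δ ^ p) (NNReal.rpow_pos hδ0)).mono fun n hn => hn.trans_eq ?_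
  rw [← ENNReal.coe_rpow_of_nonneg _ (by positivity : 0 ≤ 1 / p), ← NNReal.rpow_mul,
    mul_one_div_cancel hp.ne', NNReal.rpow_one]

theorem isCompactInclusion_bergman {p q : ℝ} (hp : 0 < p) (hq : 0 < q) {μ : Measure ℂ}
    (hμ : μ unitDiscᶜ = 0) (h : IsVanishingCarlesonMeasure (q + 1) μ) :
    IsCompactInclusion (bergmanSpace p (q - 1)) (bergmanNorm p (q - 1))
      (lebesgueSpace p μ) (lebesgueNorm p μ) := by
  obtain ⟨C, hC⟩ := exists_lintegral_le_of_isBallCarleson hp hq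
  obtain ⟨A, hA⟩ := exists_weightedIntegral_le_bergmanNorm (α := q - 1) hp (by linarith)
  obtain ⟨K, hK⟩ := h.1.exists_isBallCarleson (by linarith)
  have hmem : ∀ f, DifferentiableOn ℂ f unitDisc → weightedIntegral p (q - 1) f < ∞ →
      f ∈ lebesgueSpace p μ := by
    intro f hf hN
    refine ⟨aestronglyMeasurable_of_differentiableOn hμ hf, ?_⟩
    change lebesgueNorm p μ f < ∞
    rw [lebesgueNorm_eq hp hμ]
    refine ENNReal.rpow_lt_top_of_nonneg (by positivity) ((hC μ K f hK hf).trans_lt ?_).ne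
    exact ENNReal.mul_lt_top (by finiteness) hN
  refine ⟨fun f hf => hmem f hf.1 ((hA f).trans_lt ?_), fun f hf hbd => ?_⟩
  · exact ENNReal.mul_lt_top ENNReal.coe_lt_top (ENNReal.rpow_lt_top_of_nonneg hp.le hf.2.ne)
  obtain ⟨B, hB⟩ := hbd
  obtain ⟨g, hg, hNg, φ, hφ, hlim⟩ := exists_compact_of_vanishing hp (by linarith) h (ι := Unit)
    (S := fun _ => unitDisc) (c := fun _ => 1) (fun _ => subset_rfl)
    (fun _ _ => ⟨1, one_ne_zero, fun _ _ => le_rfl⟩) (isAnalyticSize_bergman hp hq)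
    (fun ν K f hν hf _ => by rw [mul_one]; exact hC ν K f hν hf) (f := f) (fun n => (hf n).1)
    (B := A * B ^ p) fun n => by
      refine (hA _).trans ?_
      rw [ENNReal.coe_mul, ENNReal.coe_rpow_of_nonneg _ hp.le]
      gcongr
      exact hB n
  refine ⟨g, hmem g hg hNg, φ, hφ, tendsto_zero_of_forall_eventually_le_rpow hp fun ε hε => ?_⟩
  refine (hlim ε hε).mono fun n hn => ?_
  rw [lebesgueNorm_eq hp hμ]
  gcongr
  simpa using hn ()

theorem isCompactInclusion_dirichlet {p q : ℝ} (hp : 0 < p) (hq : 0 < q) {μ : Measure ℂ}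
    (hμ : μ unitDiscᶜ = 0) (h : IsVanishingCarlesonMeasure (q + 1) μ) :
    IsCompactInclusion (dirichletSpace p) (dirichletNorm p) (tentSpace p q μ) (tentNorm p q μ) := by
  obtain ⟨C, hC⟩ := exists_lintegral_carlesonSquare_le hp hq
  obtain ⟨A, hA⟩ := exists_le_dirichletNorm hp
  obtain ⟨K, hK⟩ := h.1.exists_isBallCarleson (by linarith)
  have htent : ∀ (f : ℂ → ℂ) (M : ℝ≥0∞), (∀ θ : ℝ, ∀ ℓ ∈ Ioc (0 : ℝ) 1,
      ∫⁻ z in carlesonSquare θ ℓ, ‖f z‖ₑ ^ p ∂μ ≤ M * ENNReal.ofReal (ℓ ^ q)) →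
      tentNorm p q μ f ≤ M ^ (1 / p) := by
    intro f M hM
    rw [tentNorm]
    gcongr
    refine iSup_le fun θ => iSup_le fun ℓ => iSup_le fun hℓ => ?_
    have := Real.rpow_pos_of_pos hℓ.1 q
    rw [ENNReal.div_le_iff (by simpa using this) ENNReal.ofReal_ne_top]
    exact hM θ ℓ hℓ
  have hmem : ∀ f, DifferentiableOn ℂ f unitDisc →
      ‖f 0‖ₑ ^ p + weightedIntegral p (p - 1) (deriv f) < ∞ → f ∈ tentSpace p q μ := by
    intro f hf hN
    refine ⟨aestronglyMeasurable_of_differentiableOn hμ hf,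
      (htent f _ fun θ ℓ hℓ => hC μ K f hK hf θ ℓ hℓ).trans_lt ?_⟩
    exact ENNReal.rpow_lt_top_of_nonneg (by positivity)
      (ENNReal.mul_lt_top (by finiteness) hN).ne
  refine ⟨fun f hf => hmem f hf.1 ((hA f).trans_lt ?_), fun f hf hbd => ?_⟩
  · exact ENNReal.mul_lt_top ENNReal.coe_lt_top (ENNReal.rpow_lt_top_of_nonneg hp.le hf.2.ne)
  obtain ⟨B, hB⟩ := hbd
  obtain ⟨g, hg, hNg, φ, hφ, hlim⟩ := exists_compact_of_vanishing hp (by linarith) h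
    (ι := ℝ × Ioc (0 : ℝ) 1) (S := fun i => carlesonSquare i.1 i.2)
    (c := fun i => ENNReal.ofReal ((i.2 : ℝ) ^ q))
    (fun i => carlesonSquare_subset_unitDisc _ i.2.2.2)
    -- A square that meets |z| ≤ r has ℓ ≥ 1 - r, so (1 - r)^q is the lower bound.
    (fun r hr => by
      have hr0 : 0 < 1 - r := by linarith
      have := Real.rpow_pos_of_pos hr0 q
      refine ⟨ENNReal.ofReal ((1 - r) ^ q), by simpa using this, ?_⟩
      rintro i ⟨z, hz, hzr⟩
      have h1 := one_sub_le_norm_of_mem_carlesonSquare i.2.2.2 hz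
      have h2 : ‖z‖ ≤ r := hzr
      gcongr
      linarith) (isAnalyticSize_dirichlet hp)
    (fun ν K f hν hf i => hC ν K f hν hf i.1 i.2 i.2.2) (f := f) (fun n => (hf n).1)
    (B := A * B ^ p) fun n => by
      refine (hA _).trans ?_
      rw [ENNReal.coe_mul, ENNReal.coe_rpow_of_nonneg _ hp.le]
      gcongr
      exact hB n
  refine ⟨g, hmem g hg hNg, φ, hφ, tendsto_zero_of_forall_eventually_le_rpow hp fun ε hε => ?_⟩
  exact (hlim ε hε).mono fun n hn => htent _ _ fun θ ℓ hℓ => hn (θ, ⟨ℓ, hℓ⟩)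

/-! ### Forelli–Rudin estimates and test functions -/

/-- The function `z ↦ 1 - āz` with `a = (1 - ℓ) e^{iθ}`. -/
noncomputable def kernelDenom (θ ℓ : ℝ) (z : ℂ) : ℂ :=
  1 - ((1 - ℓ : ℝ) : ℂ) * Complex.exp ((-θ : ℝ) * Complex.I) * z

theorem le_norm_kernelDenom {θ ℓ : ℝ} (hℓ : ℓ ≤ 1) (z : ℂ) :
    1 - (1 - ℓ) * ‖z‖ ≤ ‖kernelDenom θ ℓ z‖ := by
  have h := norm_sub_norm_le (1 : ℂ) (((1 - ℓ : ℝ) : ℂ) * Complex.exp ((-θ : ℝ) * Complex.I) * z)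
  rwa [norm_mul, norm_mul, Complex.norm_exp_ofReal_mul_I, mul_one, norm_one, Complex.norm_real,
    Real.norm_of_nonneg (by linarith)] at h

theorem self_le_norm_kernelDenom {θ ℓ : ℝ} (hℓ : ℓ ≤ 1) {z : ℂ} (hz : z ∈ unitDisc) :
    ℓ ≤ ‖kernelDenom θ ℓ z‖ := by
  refine le_trans ?_ (le_norm_kernelDenom hℓ z)
  nlinarith [mem_unitDisc.1 hz]

theorem one_sub_le_norm_kernelDenom {θ ℓ : ℝ} (hℓ0 : 0 ≤ ℓ) (hℓ : ℓ ≤ 1) (z : ℂ) :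
    1 - ‖z‖ ≤ ‖kernelDenom θ ℓ z‖ := by
  refine le_trans ?_ (le_norm_kernelDenom hℓ z)
  nlinarith [norm_nonneg z]

/-- Up to a rotation the denominator is the displacement from z to the centre of the arc, with an
error of size ℓ|z|. -/
theorem exp_mul_kernelDenom (θ ℓ : ℝ) (z : ℂ) :
    Complex.exp (θ * Complex.I) * kernelDenom θ ℓ z = (Complex.exp (θ * Complex.I) - z) + ℓ * z := by
  have h : Complex.exp (θ * Complex.I) * Complex.exp ((-θ : ℝ) * Complex.I) = 1 := by
    rw [← Complex.exp_add]
    simp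
  rw [kernelDenom, mul_sub, mul_one, mul_assoc, mul_left_comm, ← mul_assoc (Complex.exp _), h]
  push_cast
  ring

theorem norm_kernelDenom (θ ℓ : ℝ) (z : ℂ) :
    ‖kernelDenom θ ℓ z‖ = ‖(Complex.exp (θ * Complex.I) - z) + ℓ * z‖ := by
  rw [← exp_mul_kernelDenom, norm_mul, Complex.norm_exp_ofReal_mul_I, one_mul]

theorem dist_le_norm_kernelDenom_add {θ ℓ : ℝ} (hℓ : 0 ≤ ℓ) (z : ℂ) :
    dist z (Complex.exp (θ * Complex.I)) ≤ ‖kernelDenom θ ℓ z‖ + ℓ * ‖z‖ := by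
  rw [norm_kernelDenom, dist_eq_norm, norm_sub_rev]
  have h := norm_sub_le ((Complex.exp (θ * Complex.I) - z) + ℓ * z) (ℓ * z)
  rwa [add_sub_cancel_right, norm_mul, Complex.norm_real, Real.norm_of_nonneg hℓ] at h

theorem norm_kernelDenom_le_of_mem_carlesonSquare {θ ℓ : ℝ} (hℓ0 : 0 < ℓ) (hℓ : ℓ ≤ 1) {z : ℂ}
    (hz : z ∈ carlesonSquare θ ℓ) : ‖kernelDenom θ ℓ z‖ ≤ 7 * ℓ := by
  have h1 := dist_lt_of_mem_carlesonSquare hℓ0 hz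
  have h2 := mem_unitDisc.1 (carlesonSquare_subset_unitDisc θ hℓ hz)
  rw [dist_eq_norm, norm_sub_rev] at h1
  rw [norm_kernelDenom]
  have h := norm_add_le (Complex.exp (θ * Complex.I) - z) (ℓ * z)
  rw [norm_mul, Complex.norm_real, Real.norm_of_nonneg hℓ0.le] at h
  nlinarith

theorem differentiable_kernelDenom (θ ℓ : ℝ) : Differentiable ℂ (kernelDenom θ ℓ) := by
  unfold kernelDenom
  fun_prop

theorem kernelDenom_ne_zero {θ ℓ : ℝ} (hℓ0 : 0 < ℓ) (hℓ : ℓ ≤ 1) {z : ℂ} (hz : z ∈ unitDisc) :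
    kernelDenom θ ℓ z ≠ 0 :=
  norm_pos_iff.1 (hℓ0.trans_le (self_le_norm_kernelDenom hℓ hz))

/-- The Forelli-Rudin type estimate for Carleson measures. -/
theorem exists_lintegral_kernelDenom_rpow_le {s c : ℝ} (hc : s < c) :
    ∃ C : ℝ≥0, ∀ (ν : Measure ℂ) (K : ℝ≥0), IsBallCarleson s K ν → ∀ θ : ℝ, ∀ ℓ ∈ Ioc (0 : ℝ) 1,
      ∫⁻ z in unitDisc, ENNReal.ofReal (‖kernelDenom θ ℓ z‖ ^ (-c)) ∂ν ≤
        C * K * ENNReal.ofReal (ℓ ^ (s - c)) := by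
  -- Here the scales grow: the denominator is at least ℓ and its sublevel sets at height t ≥ 2ℓ lie
  -- in boundary discs of radius 2t. The series converges because s < c.
  obtain ⟨C, hC⟩ := exists_lintegral_rpow_neg_le (ρ := 2) (a := s) (b := c) two_pos
    (Real.rpow_lt_one_of_one_lt_of_neg one_lt_two (by linarith))
  refine ⟨C * Real.toNNReal (2 ^ s * 2 ^ (s - c)), fun ν K hν θ ℓ hℓ => ?_⟩
  have hℓ0 : 0 < ℓ := hℓ.1
  have hm : Measurable fun z => ‖kernelDenom θ ℓ z‖ :=
    (differentiable_kernelDenom θ ℓ).continuous.norm.measurable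
  refine (hC ν unitDisc (fun z => ‖kernelDenom θ ℓ z‖) (2 * ℓ) (K * ENNReal.ofReal (2 ^ s))
    (by positivity) isOpen_unitDisc.measurableSet hm ?_ ?_).trans_eq ?_
  · intro z hz
    obtain ⟨n, hn1, hn2⟩ := exists_nat_pow_near
      ((one_le_div hℓ0).2 (self_le_norm_kernelDenom (θ := θ) hℓ.2 hz)) one_lt_two
    rw [le_div_iff₀ hℓ0] at hn1
    rw [div_lt_iff₀ hℓ0, pow_succ] at hn2
    exact ⟨n, by linarith, by linarith⟩
  · intro k
    have ht : 2 * ℓ ≤ 2 ^ k * (2 * ℓ) :=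
      le_mul_of_one_le_left (by positivity) (one_le_pow₀ one_le_two)
    set t := 2 ^ k * (2 * ℓ) with htdef
    have ht0 : 0 < t := by linarith
    have hsub : unitDisc ∩ {z | ‖kernelDenom θ ℓ z‖ ≤ t} ⊆
        Metric.ball (Complex.exp (θ * Complex.I)) (2 * t) ∩ unitDisc := by
      rintro z ⟨hz, hzt⟩
      refine ⟨?_, hz⟩
      have h1 : ‖kernelDenom θ ℓ z‖ ≤ t := hzt
      have h2 := dist_le_norm_kernelDenom_add (θ := θ) hℓ0.le z
      have h3 := mem_unitDisc.1 hz
      rw [Metric.mem_ball]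
      nlinarith
    refine (measure_mono hsub).trans
      ((hν _ (Complex.norm_exp_ofReal_mul_I θ) _ (by positivity)).trans_eq ?_)
    rw [Real.mul_rpow (by norm_num) ht0.le, ENNReal.ofReal_mul (by positivity), mul_assoc]
  · rw [Real.mul_rpow (by norm_num) hℓ0.le, ENNReal.ofReal_mul (by positivity), ENNReal.coe_mul,
      ENNReal.ofNNReal_toNNReal, ENNReal.ofReal_mul (by positivity)]
    ring

theorem exists_weighted_lintegral_kernelDenom_rpow_le {α c : ℝ} (hα : -1 < α) (hc : α + 2 < c) :
    ∃ C : ℝ≥0, ∀ θ : ℝ, ∀ ℓ ∈ Ioc (0 : ℝ) 1,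
      ∫⁻ z in unitDisc, ENNReal.ofReal (‖kernelDenom θ ℓ z‖ ^ (-c)) *
        ENNReal.ofReal ((1 - ‖z‖) ^ α) ∂areaMeasure ≤ C * ENNReal.ofReal (ℓ ^ (α + 2 - c)) := by
  obtain ⟨K, hK⟩ := exists_isBallCarleson_weighted hα
  obtain ⟨C, hC⟩ := exists_lintegral_kernelDenom_rpow_le hc
  refine ⟨C * K, fun θ ℓ hℓ => ?_⟩
  have hm : Measurable fun z => ‖kernelDenom θ ℓ z‖ :=
    (differentiable_kernelDenom θ ℓ).continuous.norm.measurable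
  have h := hC _ K hK θ ℓ hℓ
  rw [setLIntegral_withDensity_eq_setLIntegral_mul _ (by fun_prop) (by fun_prop)
    isOpen_unitDisc.measurableSet, Measure.restrict_restrict isOpen_unitDisc.measurableSet,
    inter_self] at h
  refine le_trans (le_of_eq ?_) (h.trans_eq ?_)
  · exact lintegral_congr fun z => mul_comm _ _
  · rw [ENNReal.coe_mul]

/-- The normalized test function `(1 - |a|)^{m - β} / (1 - āz)^m` with `a = (1 - ℓ) e^{iθ}`. -/
noncomputable def testFunction (m : ℕ) (β θ ℓ : ℝ) (z : ℂ) : ℂ :=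
  ((ℓ ^ (m - β) : ℝ) : ℂ) / kernelDenom θ ℓ z ^ m

theorem norm_testFunction (m : ℕ) (β θ : ℝ) {ℓ : ℝ} (hℓ : 0 < ℓ) (z : ℂ) :
    ‖testFunction m β θ ℓ z‖ = ℓ ^ (m - β) / ‖kernelDenom θ ℓ z‖ ^ m := by
  rw [testFunction, norm_div, norm_pow, Complex.norm_real, Real.norm_of_nonneg (by positivity)]

theorem differentiableOn_testFunction (m : ℕ) (β θ : ℝ) {ℓ : ℝ} (hℓ : ℓ ∈ Ioc (0 : ℝ) 1) :
    DifferentiableOn ℂ (testFunction m β θ ℓ) unitDisc :=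
  (differentiableOn_const _).div ((differentiable_kernelDenom θ ℓ).pow m).differentiableOn
    fun _ hz => pow_ne_zero _ (kernelDenom_ne_zero hℓ.1 hℓ.2 hz)

theorem norm_deriv_testFunction_le (m : ℕ) (β θ : ℝ) {ℓ : ℝ} (hℓ : ℓ ∈ Ioc (0 : ℝ) 1) {z : ℂ}
    (hz : z ∈ unitDisc) :
    ‖deriv (testFunction m β θ ℓ) z‖ ≤ m * (ℓ ^ (m - β) / ‖kernelDenom θ ℓ z‖ ^ (m + 1)) := by
  have hne := kernelDenom_ne_zero (θ := θ) hℓ.1 hℓ.2 hz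
  have hd : HasDerivAt (kernelDenom θ ℓ)
      (-(((1 - ℓ : ℝ) : ℂ) * Complex.exp ((-θ : ℝ) * Complex.I))) z := by
    unfold kernelDenom
    simpa using ((hasDerivAt_id z).const_mul
      (((1 - ℓ : ℝ) : ℂ) * Complex.exp ((-θ : ℝ) * Complex.I))).const_sub 1
  have hder := (((hd.pow m).inv (pow_ne_zero _ hne)).const_mul ((ℓ ^ (m - β) : ℝ) : ℂ)).deriv
  have hfun : testFunction m β θ ℓ =
      fun y => ((ℓ ^ (m - β) : ℝ) : ℂ) * ((kernelDenom θ ℓ ^ m)⁻¹) y := by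
    ext y
    simp [testFunction, div_eq_mul_inv]
  rw [hfun, hder]
  have hpos : 0 < ‖kernelDenom θ ℓ z‖ := norm_pos_iff.2 hne
  have h0 : 0 ≤ ℓ ^ (m - β) := Real.rpow_nonneg hℓ.1.le _
  simp only [Pi.pow_apply, norm_mul, norm_div, norm_neg, norm_pow, Complex.norm_real,
    Complex.norm_natCast, Complex.norm_exp_ofReal_mul_I, mul_one, Real.norm_of_nonneg h0,
    Real.norm_of_nonneg (sub_nonneg.2 hℓ.2)]
  -- The exponent `m - 1` is truncated subtraction, so the constant function m = 0 is separate.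
  rcases Nat.eq_zero_or_pos m with rfl | hm
  · simp
  · have h1 : ‖kernelDenom θ ℓ z‖ ^ (m - 1) / (‖kernelDenom θ ℓ z‖ ^ m) ^ 2 =
        1 / ‖kernelDenom θ ℓ z‖ ^ (m + 1) := by
      rw [div_eq_div_iff (by positivity) (by positivity), one_mul, ← pow_add, ← pow_mul]
      congr 1
      omega
    calc ℓ ^ (m - β) * (m * ‖kernelDenom θ ℓ z‖ ^ (m - 1) * (1 - ℓ) /
          (‖kernelDenom θ ℓ z‖ ^ m) ^ 2)
        = m * ℓ ^ (m - β) * (1 - ℓ) * (‖kernelDenom θ ℓ z‖ ^ (m - 1) /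
          (‖kernelDenom θ ℓ z‖ ^ m) ^ 2) := by ring
      _ ≤ m * ℓ ^ (m - β) * 1 * (1 / ‖kernelDenom θ ℓ z‖ ^ (m + 1)) := by
          rw [h1]
          gcongr
          linarith [hℓ.1]
      _ = _ := by ring

/-- The weighted integral of a multiple of a power of the kernel. -/
theorem exists_weightedIntegral_le_of_kernel_bound {p α γ : ℝ} (hp : 0 < p) {k : ℕ} (hα : -1 < α)
    (hk : α + 2 < k * p) (hγ : γ * p + α + 2 - k * p = 0) (A : ℝ≥0) :
    ∃ C : ℝ≥0, ∀ θ : ℝ, ∀ ℓ ∈ Ioc (0 : ℝ) 1, ∀ f : ℂ → ℂ,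
      (∀ z ∈ unitDisc, ‖f z‖ ≤ A * (ℓ ^ γ / ‖kernelDenom θ ℓ z‖ ^ k)) →
      weightedIntegral p α f ≤ C := by
  obtain ⟨C, hC⟩ := exists_weighted_lintegral_kernelDenom_rpow_le hα hk
  refine ⟨A ^ p * C, fun θ ℓ hℓ f hf => ?_⟩
  have hℓ0 : 0 < ℓ := hℓ.1
  calc weightedIntegral p α f
      ≤ ∫⁻ z in unitDisc, ENNReal.ofReal (A ^ p * ℓ ^ (γ * p)) *
          (ENNReal.ofReal (‖kernelDenom θ ℓ z‖ ^ (-(k * p))) *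
          ENNReal.ofReal ((1 - ‖z‖) ^ α)) ∂areaMeasure := by
        refine setLIntegral_mono' isOpen_unitDisc.measurableSet fun z hz => ?_
        have hpos : 0 < ‖kernelDenom θ ℓ z‖ := norm_pos_iff.2 (kernelDenom_ne_zero hℓ0 hℓ.2 hz)
        rw [← mul_assoc, enorm_rpow_eq_ofReal hp.le,
          ← ENNReal.ofReal_mul (p := (A : ℝ) ^ p * ℓ ^ (γ * p)) (by positivity)]
        gcongr
        refine (Real.rpow_le_rpow (norm_nonneg _) (hf z hz) hp.le).trans_eq ?_
        rw [Real.mul_rpow A.coe_nonneg (by positivity), Real.div_rpow (by positivity) (by positivity),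
          ← Real.rpow_mul hℓ0.le, ← Real.rpow_natCast, ← Real.rpow_mul hpos.le,
          Real.rpow_neg hpos.le]
        ring
    _ = ENNReal.ofReal (A ^ p * ℓ ^ (γ * p)) * ∫⁻ z in unitDisc,
          ENNReal.ofReal (‖kernelDenom θ ℓ z‖ ^ (-(k * p))) *
          ENNReal.ofReal ((1 - ‖z‖) ^ α) ∂areaMeasure :=
        lintegral_const_mul' _ _ ENNReal.ofReal_ne_top
    _ ≤ ENNReal.ofReal (A ^ p * ℓ ^ (γ * p)) * (C * ENNReal.ofReal (ℓ ^ (α + 2 - k * p))) := by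
        gcongr
        exact hC θ ℓ hℓ
    -- The balance condition `hγ` cancels all powers of ℓ.
    _ = C * ENNReal.ofReal (A ^ p) := by
        rw [mul_left_comm, ← ENNReal.ofReal_mul (by positivity), mul_assoc, ← Real.rpow_add hℓ0,
          show γ * p + (α + 2 - k * p) = 0 by linarith, Real.rpow_zero, mul_one]
    _ = _ := by
        rw [ENNReal.coe_mul, mul_comm, ← NNReal.coe_rpow, ENNReal.ofReal_coe_nnreal]

theorem tendsto_testFunction {m : ℕ} {β : ℝ} (hβ : β < m) {θ ℓ : ℕ → ℝ}
    (hℓ : ∀ n, ℓ n ∈ Ioc (0 : ℝ) 1) (hℓ0 : Tendsto ℓ atTop (𝓝 0)) {z : ℂ} (hz : z ∈ unitDisc) :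
    Tendsto (fun n => testFunction m β (θ n) (ℓ n) z) atTop (𝓝 0) := by
  have hz0 : 0 < 1 - ‖z‖ := by linarith [mem_unitDisc.1 hz]
  have hlim : Tendsto (fun n => ℓ n ^ (m - β) / (1 - ‖z‖) ^ m) atTop (𝓝 0) := by
    have h1 := ((Real.continuous_rpow_const (sub_pos.2 hβ).le).tendsto (0 : ℝ)).comp hℓ0
    rw [Real.zero_rpow (sub_pos.2 hβ).ne'] at h1
    simpa using h1.div_const ((1 - ‖z‖) ^ m)
  refine squeeze_zero_norm (fun n => ?_) hlim
  rw [norm_testFunction m β (θ n) (hℓ n).1]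
  have := (hℓ n).1
  gcongr
  exact one_sub_le_norm_kernelDenom (hℓ n).1.le (hℓ n).2 z

theorem testFunction_one (m : ℕ) (β θ : ℝ) (z : ℂ) : testFunction m β θ 1 z = 1 := by
  simp [testFunction, kernelDenom]

theorem exists_bergmanNorm_testFunction_le {p q : ℝ} (hp : 0 < p) (hq : 0 < q) {m : ℕ}
    (hm : q + 1 < m * p) : ∃ C : ℝ≥0, ∀ θ : ℝ, ∀ ℓ ∈ Ioc (0 : ℝ) 1,
      bergmanNorm p (q - 1) (testFunction m ((q + 1) / p) θ ℓ) ≤ C := by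
  obtain ⟨A, hA⟩ := exists_bergmanNorm_le_weightedIntegral (α := q - 1) hp (by linarith)
  obtain ⟨C, hC⟩ := exists_weightedIntegral_le_of_kernel_bound (α := q - 1)
    (γ := m - (q + 1) / p) (k := m) hp (by linarith) (by linarith) (by field_simp; ring) 1
  refine ⟨(A * C) ^ (1 / p), fun θ ℓ hℓ => ?_⟩
  rw [ENNReal.coe_rpow_of_nonneg _ (by positivity), one_div, ENNReal.le_rpow_inv_iff hp,
    ENNReal.coe_mul]
  refine (hA _).trans ?_
  gcongr
  exact hC θ ℓ hℓ _ fun z _ => by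
    rw [norm_testFunction _ _ _ hℓ.1, NNReal.coe_one, one_mul]

/-- Differentiation raises the kernel power to m + 1, which for the weight p - 1 balances exactly
when β = 1/p; at the origin the function equals ℓ^(m-1/p) ≤ 1. -/
theorem exists_dirichletNorm_testFunction_le {p : ℝ} (hp : 0 < p) {m : ℕ} (hm : 1 < m * p) :
    ∃ C : ℝ≥0, ∀ θ : ℝ, ∀ ℓ ∈ Ioc (0 : ℝ) 1,
      dirichletNorm p (testFunction m (1 / p) θ ℓ) ≤ C := by
  obtain ⟨A, hA⟩ := exists_dirichletNorm_le hp
  obtain ⟨C, hC⟩ := exists_weightedIntegral_le_of_kernel_bound (α := p - 1)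
    (γ := m - 1 / p) (k := m + 1) hp (by linarith) (by push_cast; linarith)
    (by push_cast; field_simp; ring) m
  refine ⟨(A * (1 + C)) ^ (1 / p), fun θ ℓ hℓ => ?_⟩
  rw [ENNReal.coe_rpow_of_nonneg _ (by positivity), one_div, ENNReal.le_rpow_inv_iff hp,
    ENNReal.coe_mul, ENNReal.coe_add, ENNReal.coe_one]
  refine (hA _).trans ?_
  gcongr
  · have h1 : ‖testFunction m p⁻¹ θ ℓ 0‖ ≤ 1 := by
      rw [norm_testFunction _ _ _ hℓ.1]
      have h2 : 0 ≤ m - p⁻¹ := by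
        rw [sub_nonneg, inv_le_iff_one_le_mul₀ hp]
        exact hm.le
      simpa [kernelDenom] using Real.rpow_le_one hℓ.1.le hℓ.2 h2
    rw [enorm_rpow_eq_ofReal hp.le, ← ENNReal.ofReal_one]
    exact ENNReal.ofReal_le_ofReal (Real.rpow_le_one (norm_nonneg _) h1 hp.le)
  · exact hC θ ℓ hℓ _ fun z hz => by
      simpa using norm_deriv_testFunction_le m p⁻¹ θ hℓ hz

/-! ### Necessity of the vanishing condition -/

/-- The vanishing Carleson condition can be tested along subsequences. -/
theorem isVanishingCarlesonMeasure_of_forall_exists_subseq {s : ℝ} (hs : 0 ≤ s) {μ : Measure ℂ}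
    (hμ : μ unitDisc < ∞)
    (h : ∀ θ ℓ : ℕ → ℝ, (∀ n, ℓ n ∈ Ioc (0 : ℝ) 1) → Tendsto ℓ atTop (𝓝 0) →
      ∃ φ : ℕ → ℕ, Tendsto (fun n => μ (carlesonSquare (θ (φ n)) (ℓ (φ n))) /
        ENNReal.ofReal (ℓ (φ n) ^ s)) atTop (𝓝 0)) :
    IsVanishingCarlesonMeasure s μ := by
  have hlim : Tendsto (fun ℓ : ℝ => ⨆ θ : ℝ, μ (carlesonSquare θ ℓ) / ENNReal.ofReal (ℓ ^ s))
      (𝓝[>] 0) (𝓝 0) := by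
    by_contra hcon
    rw [ENNReal.tendsto_nhds_zero] at hcon
    push Not at hcon
    obtain ⟨ε, hε, hfr⟩ := hcon
    have hex : ∀ n : ℕ, ∃ ℓ ∈ Ioo (0 : ℝ) (1 / (n + 1)), ∃ θ : ℝ,
        ε < μ (carlesonSquare θ ℓ) / ENNReal.ofReal (ℓ ^ s) := by
      intro n
      have hn : (0 : ℝ) < 1 / (n + 1) := by positivity
      obtain ⟨ℓ, h1, h2⟩ := (hfr.and_eventually (Ioo_mem_nhdsGT hn)).exists
      obtain ⟨θ, hθ⟩ := lt_iSup_iff.1 h1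
      exact ⟨ℓ, h2, θ, hθ⟩
    choose ℓ hℓ θ hθ using hex
    have hℓ1 : ∀ n, ℓ n ∈ Ioc (0 : ℝ) 1 := fun n => ⟨(hℓ n).1, (hℓ n).2.le.trans <| by
      rw [div_le_one (by positivity)]
      linarith [n.cast_nonneg (α := ℝ)]⟩
    obtain ⟨φ, hφ⟩ := h θ ℓ hℓ1 (squeeze_zero (fun n => (hℓ n).1.le) (fun n => (hℓ n).2.le)
      tendsto_one_div_add_atTop_nhds_zero_nat)
    exact absurd (ge_of_tendsto' hφ fun n => (hθ (φ n)).le) (not_le.2 hε)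
  refine ⟨?_, hlim⟩
  have hev := hlim.eventually_lt_const (zero_lt_one)
  rw [eventually_iff, mem_nhdsGT_iff_exists_Ioo_subset] at hev
  obtain ⟨δ, hδ, hev⟩ := hev
  rw [mem_Ioi] at hδ
  have hδs := Real.rpow_pos_of_pos hδ s
  -- The limit bounds the ratio by 1 for short arcs; for arcs with ℓ ≥ δ the finite total mass
  -- suffices.
  have hle : carlesonNorm s μ ≤ 1 + μ unitDisc / ENNReal.ofReal (δ ^ s) := by
    refine iSup_le fun θ => iSup_le fun ℓ => iSup_le fun hℓ => ?_
    rcases lt_or_ge ℓ δ with h1 | h1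
    · refine le_trans ?_ le_self_add
      exact (le_iSup (fun θ => μ (carlesonSquare θ ℓ) / ENNReal.ofReal (ℓ ^ s)) θ).trans
        (le_of_lt (hev (show ℓ ∈ Ioo 0 δ from ⟨hℓ.1, h1⟩)))
    · refine le_trans ?_ le_add_self
      gcongr
      exact carlesonSquare_subset_unitDisc θ hℓ.2
  exact hle.trans_lt (ENNReal.add_lt_top.2
    ⟨ENNReal.one_lt_top, ENNReal.div_lt_top hμ.ne (by simpa using hδs)⟩)

/-- If `f n` tends to zero pointwise and `f n - g` tends to zero in `L^p(μ)`, then `g = 0`. -/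
theorem ae_eq_zero_of_tendsto_lintegral {p : ℝ} (hp : 0 < p) {μ : Measure ℂ}
    {f : ℕ → ℂ → ℂ} {g : ℂ → ℂ} (hf : ∀ n, DifferentiableOn ℂ (f n) unitDisc)
    (hg : AEStronglyMeasurable g μ)
    (hlim : ∀ z ∈ unitDisc, Tendsto (fun n => f n z) atTop (𝓝 0))
    (hint : Tendsto (fun n => ∫⁻ z in unitDisc, ‖f n z - g z‖ₑ ^ p ∂μ) atTop (𝓝 0)) :
    ∀ᵐ z ∂(μ.restrict unitDisc), g z = 0 := by
  have hm : ∀ n, AEMeasurable (fun z => ‖f n z - g z‖ₑ ^ p) (μ.restrict unitDisc) := fun n =>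
    (((hf n).continuousOn.aestronglyMeasurable isOpen_unitDisc.measurableSet).sub
      hg.restrict).enorm.pow_const p
  have hzero : ∫⁻ z in unitDisc, ‖g z‖ₑ ^ p ∂μ = 0 := by
    refine le_antisymm ?_ zero_le
    calc ∫⁻ z in unitDisc, ‖g z‖ₑ ^ p ∂μ
        = ∫⁻ z in unitDisc, liminf (fun n => ‖f n z - g z‖ₑ ^ p) atTop ∂μ := by
          refine setLIntegral_congr_fun isOpen_unitDisc.measurableSet fun z hz => ?_
          refine (Tendsto.liminf_eq ?_).symm
          have h1 := ((hlim z hz).sub_const (g z)).enorm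
          rw [zero_sub, enorm_neg] at h1
          exact ((ENNReal.continuous_rpow_const (y := p)).tendsto _).comp h1
      _ ≤ liminf (fun n => ∫⁻ z in unitDisc, ‖f n z - g z‖ₑ ^ p ∂μ) atTop :=
          lintegral_liminf_le' hm
      _ = 0 := hint.liminf_eq
  have hgm : AEMeasurable (fun z => ‖g z‖ₑ ^ p) (μ.restrict unitDisc) :=
    hg.restrict.enorm.pow_const p
  rw [lintegral_eq_zero_iff' hgm] at hzero
  filter_upwards [hzero] with z hz
  rw [Pi.zero_apply, ENNReal.rpow_eq_zero_iff_of_pos hp] at hz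
  simpa using hz

/-- On its own square the denominator is at most 7ℓ, so |testFunction|^p is at least 7^(-mp) ℓ^(-βp)
there; subtracting the null function g changes nothing. -/
theorem measure_carlesonSquare_le_of_testFunction {p : ℝ} (hp : 0 < p) (m : ℕ) {β : ℝ}
    {μ : Measure ℂ} {g : ℂ → ℂ} (hg : ∀ᵐ z ∂(μ.restrict unitDisc), g z = 0) (θ : ℝ) {ℓ : ℝ}
    (hℓ : ℓ ∈ Ioc (0 : ℝ) 1) :
    μ (carlesonSquare θ ℓ) / ENNReal.ofReal (ℓ ^ (β * p)) ≤ ENNReal.ofReal (7 ^ (m * p)) *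
      ∫⁻ z in carlesonSquare θ ℓ, ‖testFunction m β θ ℓ z - g z‖ₑ ^ p ∂μ := by
  have hℓ0 : 0 < ℓ := hℓ.1
  have hsub := carlesonSquare_subset_unitDisc θ hℓ.2
  have hpow : 0 < ℓ ^ (β * p) := by positivity
  have hcongr : ∫⁻ z in carlesonSquare θ ℓ, ‖testFunction m β θ ℓ z - g z‖ₑ ^ p ∂μ =
      ∫⁻ z in carlesonSquare θ ℓ, ‖testFunction m β θ ℓ z‖ₑ ^ p ∂μ := by
    refine lintegral_congr_ae ?_
    filter_upwards [ae_restrict_of_ae_restrict_of_subset hsub hg] with z hz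
    rw [hz, sub_zero]
  have hlow : ∀ z ∈ carlesonSquare θ ℓ, ENNReal.ofReal (7 ^ (-(m * p)) * (ℓ ^ (β * p))⁻¹) ≤
      ‖testFunction m β θ ℓ z‖ₑ ^ p := by
    intro z hz
    have hpos := norm_pos_iff.2 (kernelDenom_ne_zero (θ := θ) hℓ0 hℓ.2 (hsub hz))
    rw [enorm_rpow_eq_ofReal hp.le]
    refine ENNReal.ofReal_le_ofReal ?_
    calc (7 : ℝ) ^ (-(m * p)) * (ℓ ^ (β * p))⁻¹ = (ℓ ^ (m - β) / (7 * ℓ) ^ m) ^ p := by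
          rw [Real.div_rpow (by positivity) (by positivity), ← Real.rpow_natCast,
            ← Real.rpow_mul hℓ0.le, ← Real.rpow_mul (by positivity : 0 ≤ 7 * ℓ),
            Real.mul_rpow (by norm_num) hℓ0.le, Real.rpow_neg (by norm_num), sub_mul,
            Real.rpow_sub hℓ0]
          have : ℓ ^ (m * p) ≠ 0 := by positivity
          field_simp
      _ ≤ _ := by
          rw [norm_testFunction m β θ hℓ0]
          gcongr
          exact norm_kernelDenom_le_of_mem_carlesonSquare hℓ0 hℓ.2 hz
  have hint : ENNReal.ofReal (7 ^ (-(m * p)) * (ℓ ^ (β * p))⁻¹) * μ (carlesonSquare θ ℓ) ≤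
      ∫⁻ z in carlesonSquare θ ℓ, ‖testFunction m β θ ℓ z‖ₑ ^ p ∂μ := by
    have hm : Measurable (testFunction m β θ ℓ) :=
      measurable_const.div ((differentiable_kernelDenom θ ℓ).continuous.pow m).measurable
    rw [← Measure.restrict_apply_univ (carlesonSquare θ ℓ), ← lintegral_const]
    exact setLIntegral_mono (by fun_prop) hlow
  rw [hcongr]
  calc μ (carlesonSquare θ ℓ) / ENNReal.ofReal (ℓ ^ (β * p))
      = ENNReal.ofReal (7 ^ (m * p)) * (ENNReal.ofReal (7 ^ (-(m * p)) * (ℓ ^ (β * p))⁻¹) *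
          μ (carlesonSquare θ ℓ)) := by
        rw [← mul_assoc, ← ENNReal.ofReal_mul (by positivity), ← mul_assoc,
          ← Real.rpow_add (by norm_num), add_neg_cancel, Real.rpow_zero, one_mul,
          ENNReal.ofReal_inv_of_pos hpow, div_eq_mul_inv, mul_comm]
    _ ≤ _ := by gcongr

theorem tendsto_mul_rpow_zero {p : ℝ} (hp : 0 < p) (c : ℝ) {u : ℕ → ℝ≥0∞}
    (h : Tendsto u atTop (𝓝 0)) : Tendsto (fun n => ENNReal.ofReal c * u n ^ p) atTop (𝓝 0) := by
  have h1 := ((ENNReal.continuous_rpow_const (y := p)).tendsto 0).comp h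
  rw [ENNReal.zero_rpow_of_pos hp] at h1
  simpa using ENNReal.Tendsto.const_mul h1 (Or.inr ENNReal.ofReal_ne_top)

/-- The test functions are bounded and tend to 0 pointwise, so any subsequential limit in L^p(μ) is
null; their vanishing norms then dominate the Carleson ratios, as βp = q + 1. -/
theorem isVanishingCarlesonMeasure_of_bergman {p q : ℝ} (hp : 0 < p) (hq : 0 < q) {μ : Measure ℂ}
    (hμ : μ unitDiscᶜ = 0)
    (h : IsCompactInclusion (bergmanSpace p (q - 1)) (bergmanNorm p (q - 1))
      (lebesgueSpace p μ) (lebesgueNorm p μ)) : IsVanishingCarlesonMeasure (q + 1) μ := by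
  obtain ⟨m, hm⟩ := exists_nat_gt ((q + 1) / p)
  rw [div_lt_iff₀ hp] at hm
  obtain ⟨C, hC⟩ := exists_bergmanNorm_testFunction_le hp hq hm
  have hβm : (q + 1) / p < m := by rwa [div_lt_iff₀ hp]
  have hβp : (q + 1) / p * p = q + 1 := div_mul_cancel₀ _ hp.ne'
  set β := (q + 1) / p with hβ
  have hmem : ∀ θ : ℝ, ∀ ℓ ∈ Ioc (0 : ℝ) 1, testFunction m β θ ℓ ∈ bergmanSpace p (q - 1) :=
    fun θ ℓ hℓ => ⟨differentiableOn_testFunction m β θ hℓ,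
      (hC θ ℓ hℓ).trans_lt ENNReal.coe_lt_top⟩
  have hpow : ∀ f, lebesgueNorm p μ f ^ p = ∫⁻ z in unitDisc, ‖f z‖ₑ ^ p ∂μ := fun f => by
    rw [lebesgueNorm_eq hp hμ, ← ENNReal.rpow_mul, one_div_mul_cancel hp.ne', ENNReal.rpow_one]
  -- The test function with ℓ = 1 is the constant 1.
  have hfin : μ unitDisc < ∞ := by
    have h1 : lebesgueNorm p μ (testFunction m β 0 1) < ∞ := (h.1 (hmem 0 1 (by norm_num))).2
    have h2 := ENNReal.rpow_lt_top_of_nonneg hp.le h1.ne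
    simpa [hpow, testFunction_one] using h2
  refine isVanishingCarlesonMeasure_of_forall_exists_subseq (by linarith) hfin
    fun θ ℓ hℓ hℓ0 => ?_
  obtain ⟨g, hg, φ, hφ, hlim⟩ := h.2 (fun n => testFunction m β (θ n) (ℓ n))
    (fun n => hmem _ _ (hℓ n)) ⟨C, fun n => hC _ _ (hℓ n)⟩
  have hint := tendsto_mul_rpow_zero hp 1 hlim
  simp only [hpow, ENNReal.ofReal_one, one_mul] at hint
  have hg0 := ae_eq_zero_of_tendsto_lintegral hp
    (fun n => differentiableOn_testFunction m β (θ (φ n)) (hℓ (φ n))) hg.1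
    (fun z hz => tendsto_testFunction hβm (fun n => hℓ (φ n)) (hℓ0.comp hφ.tendsto_atTop) hz) hint
  refine ⟨φ, tendsto_of_tendsto_of_tendsto_of_le_of_le tendsto_const_nhds
    (tendsto_mul_rpow_zero hp (7 ^ (m * p)) hlim) (fun _ => zero_le) fun n => ?_⟩
  have h1 := measure_carlesonSquare_le_of_testFunction (β := β) hp m hg0 (θ (φ n)) (hℓ (φ n))
  rw [hβp] at h1
  refine h1.trans ?_
  rw [hpow]
  gcongr
  exact carlesonSquare_subset_unitDisc _ (hℓ (φ n)).2

/-- Now βp = 1, so the test functions yield only μ(S(I)) / |I|; the factor |I|^(-q) of the tent norm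
supplies the rest. The square with ℓ = 1 shows that the tent norm dominates the L^p norm over the
disc, which identifies the limit as null. -/
theorem isVanishingCarlesonMeasure_of_dirichlet {p q : ℝ} (hp : 0 < p) (hq : 0 < q) {μ : Measure ℂ}
    (h : IsCompactInclusion (dirichletSpace p) (dirichletNorm p)
      (tentSpace p q μ) (tentNorm p q μ)) : IsVanishingCarlesonMeasure (q + 1) μ := by
  obtain ⟨m, hm⟩ := exists_nat_gt (1 / p)
  have hβm := hm
  rw [div_lt_iff₀ hp] at hm
  obtain ⟨C, hC⟩ := exists_dirichletNorm_testFunction_le hp hm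
  have hβp : 1 / p * p = 1 := div_mul_cancel₀ _ hp.ne'
  set β := 1 / p with hβ
  have hmem : ∀ θ : ℝ, ∀ ℓ ∈ Ioc (0 : ℝ) 1, testFunction m β θ ℓ ∈ dirichletSpace p :=
    fun θ ℓ hℓ => ⟨differentiableOn_testFunction m β θ hℓ,
      (hC θ ℓ hℓ).trans_lt ENNReal.coe_lt_top⟩
  have hsq : ∀ f, ∀ θ : ℝ, ∀ ℓ ∈ Ioc (0 : ℝ) 1,
      (∫⁻ z in carlesonSquare θ ℓ, ‖f z‖ₑ ^ p ∂μ) / ENNReal.ofReal (ℓ ^ q) ≤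
        tentNorm p q μ f ^ p := fun f θ ℓ hℓ => by
    rw [tentNorm, ← ENNReal.rpow_mul, one_div_mul_cancel hp.ne', ENNReal.rpow_one]
    exact le_iSup_of_le θ (le_iSup_of_le ℓ (le_iSup_of_le hℓ le_rfl))
  have hdisc : ∀ f, ∫⁻ z in unitDisc, ‖f z‖ₑ ^ p ∂μ ≤ tentNorm p q μ f ^ p := fun f => by
    simpa [carlesonSquare_one] using hsq f 0 1 (by norm_num)
  have hfin : μ unitDisc < ∞ := by
    have h1 := (h.1 (hmem 0 1 (by norm_num))).2
    have h2 := (hdisc _).trans_lt (ENNReal.rpow_lt_top_of_nonneg hp.le h1.ne)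
    simpa [testFunction_one] using h2
  refine isVanishingCarlesonMeasure_of_forall_exists_subseq (by linarith) hfin
    fun θ ℓ hℓ hℓ0 => ?_
  obtain ⟨g, hg, φ, hφ, hlim⟩ := h.2 (fun n => testFunction m β (θ n) (ℓ n))
    (fun n => hmem _ _ (hℓ n)) ⟨C, fun n => hC _ _ (hℓ n)⟩
  have hint := tendsto_mul_rpow_zero hp 1 hlim
  simp only [ENNReal.ofReal_one, one_mul] at hint
  have hg0 := ae_eq_zero_of_tendsto_lintegral hp
    (fun n => differentiableOn_testFunction m β (θ (φ n)) (hℓ (φ n))) hg.1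
    (fun z hz => tendsto_testFunction hβm (fun n => hℓ (φ n)) (hℓ0.comp hφ.tendsto_atTop) hz)
    (tendsto_of_tendsto_of_tendsto_of_le_of_le tendsto_const_nhds hint (fun _ => zero_le)
      fun n => hdisc _)
  refine ⟨φ, tendsto_of_tendsto_of_tendsto_of_le_of_le tendsto_const_nhds
    (tendsto_mul_rpow_zero hp (7 ^ (m * p)) hlim) (fun _ => zero_le) fun n => ?_⟩
  have hℓn := hℓ (φ n)
  have hpos : 0 < ℓ (φ n) := hℓn.1
  have hq0 : 0 < ℓ (φ n) ^ q := by positivity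
  have h1 := measure_carlesonSquare_le_of_testFunction (β := β) hp m hg0 (θ (φ n)) hℓn
  rw [hβp, Real.rpow_one] at h1
  calc μ (carlesonSquare (θ (φ n)) (ℓ (φ n))) / ENNReal.ofReal (ℓ (φ n) ^ (q + 1))
      = μ (carlesonSquare (θ (φ n)) (ℓ (φ n))) / ENNReal.ofReal (ℓ (φ n)) /
          ENNReal.ofReal (ℓ (φ n) ^ q) := by
        rw [Real.rpow_add_one hpos.ne', ENNReal.ofReal_mul hq0.le, div_eq_mul_inv, div_eq_mul_inv,
          div_eq_mul_inv, ENNReal.mul_inv (by simp [hq0]) (by simp), mul_assoc,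
          mul_comm (ENNReal.ofReal (ℓ (φ n) ^ q))⁻¹]
    _ ≤ ENNReal.ofReal (7 ^ (m * p)) * (∫⁻ z in carlesonSquare (θ (φ n)) (ℓ (φ n)),
          ‖testFunction m β (θ (φ n)) (ℓ (φ n)) z - g z‖ₑ ^ p ∂μ) /
          ENNReal.ofReal (ℓ (φ n) ^ q) := ENNReal.div_le_div_right h1 _
    _ ≤ _ := by
        rw [mul_div_assoc]
        gcongr
        exact hsq _ _ _ hℓn

end DirichletEmbedding

theorem mainTheorem2 (p q : ℝ) (hp : 0 < p) (hq : 0 < q)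
    (μ : Measure ℂ) (hμ : μ unitDiscᶜ = 0) :
    List.TFAE [
      IsCompactInclusion (dirichletSpace p) (dirichletNorm p)
        (tentSpace p q μ) (tentNorm p q μ),
      IsVanishingCarlesonMeasure (q + 1) μ,
      IsCompactInclusion (bergmanSpace p (q - 1)) (bergmanNorm p (q - 1))
        (lebesgueSpace p μ) (lebesgueNorm p μ)] := by
  tfae_have 1 → 2 := isVanishingCarlesonMeasure_of_dirichlet hp hq
  tfae_have 2 → 1 := isCompactInclusion_dirichlet hp hq hμ
  tfae_have 2 → 3 := isCompactInclusion_bergman hp hq hμ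
  tfae_have 3 → 2 := isVanishingCarlesonMeasure_of_bergman hp hq hμ
  tfae_finish
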